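/- Let $V:\mathbb R^3\to\mathbb R$ satisfy $\langle x\rangle^{\kappa}V\in L^2(\mathbb R^3)$ for some $\kappa>5$, where $\langle x\rangle=(1+|x|^2)^{1/2}$, and let $p\ge 0$ be the largest integer with $\kappa>2p+5$. Let $H=(-\Delta)^2+V$ in $L^2(\mathbb R^3)$, with domain $H^4(\mathbb R^3)$, and $R(H;z)=(H-z)^{-1}$. Put $$v=|V|^{1/2},\qquad U(x)=\begin{cases}1,&V(x)\ge 0,\\-1,&V(x)<0,\end{cases}\qquad w=Uv,\qquad \alpha=\|v\|_{L^2}^2,$$ let $P=\alpha^{-1}\langle v,\cdot\rangle v$ be the orthogonal projection of $L^2(\mathbb R^3)$ onto the span of $v$ ($P=0$ if $V=0$ a.e.), let $Q=1-P$, and let $G_0$ be the operator with kernel $-\frac{|x-y|}{8\pi}$. Let $m_0=Q(U+vG_0v)Q$, regarded as a bounded operator on $QL^2(\mathbb R^3)$. Assume that $0$ is a regular point for $H$, i.e. that $m_0$ is boundedly invertible on $QL^2(\mathbb R^3)$. Then there are $\mu_0>0$ and $C\geq 0$ such that for every $\mu\in\mathbb C$ with $\operatorname{Re}\mu>0$,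 $\operatorname{Im}\mu>0$ and $|\mu|\le\mu_0$, the point $\mu^4$ belongs to the resolvent set of $H$, the operator $wR(H;\mu^4)w$, defined on the dense subspace $\{f\in L^2(\mathbb R^3): wf\in L^2(\mathbb R^3)\}$, extends to a bounded operator on $L^2(\mathbb R^3)$, and $$wR(H;\mu^4)w=U-Qm_0^{-1}Q+\sum_{j=1}^{p-1}M'_j\mu^j+\mu^p\,\mathfrak R(\mu)\qquad\text{in }\mathcal B(L^2(\mathbb R^3)),$$ with $\|\mathfrak R(\mu)\|\le C$. Here the $M'_j$ are bounded operators on $L^2(\mathbb R^3)$ that do not depend on $\mu$ and are given explicitly as follows. Let $M_0=U+vG_0v$, for $j\ge1$ let $M_j$ be the integral operator with kernel $-\frac{i^j+(-1)^j}{8\pi(j+2)!}\,v(x)|x-y|^{j+1}v(y)$, and let $c=\frac{(1+i)\alpha}{8\pi}$ (with $c^{-1}:=0$ if $V=0$ a.e.). Put $N_0=Qm_0^{-1}Q$ and, for $k\ge1$, $$N_k=(1-N_0M_0)\,c^{-1}P\Big(\delta_{k,1}-\sum_{l=0}^{k-1}M_{k-1-l}N_l\Big)-N_0\sum_{l=0}^{k-1}M_{k-l}N_l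 .$$ Then $M'_j=-N_j$ for $1\le j\le p-1$. -/

import Mathlib

open MeasureTheory Laplacian TemperedDistribution
open scoped ENNReal SchwartzMap

noncomputable section

namespace FourthOrder

/-- Three-dimensional Euclidean space. -/
abbrev E3 : Type := EuclideanSpace ℝ (Fin 3)

/-- The complex Hilbert space `L²(ℝ³)`. -/
abbrev L2 : Type := Lp ℂ 2 (volume : Measure E3)

/-! ### Multiplication operators and integral operators -/

/-- The subspace of all `f ∈ L²(ℝ³)` with `m f ∈ L²(ℝ³)`. -/
def mulDomain (m : E3 → ℂ) : Submodule ℂ L2 where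
  carrier := {f | MemLp (fun x => m x * f x) 2 volume}
  add_mem' := by
    intro f g hf hg
    refine (memLp_congr_ae ?_).2 (MemLp.add hf hg)
    filter_upwards [Lp.coeFn_add f g] with x hx
    rw [hx, Pi.add_apply, Pi.add_apply, mul_add]
  zero_mem' := by
    refine (memLp_congr_ae ?_).2 (MemLp.zero' (ε := ℂ) (p := 2) (μ := (volume : Measure E3)))
    filter_upwards [Lp.coeFn_zero ℂ 2 (volume : Measure E3)] with x hx
    rw [hx, Pi.zero_apply, mul_zero]
  smul_mem' := by
    intro c f hf
    refine (memLp_congr_ae ?_).2 (MemLp.const_smul hf c)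
    filter_upwards [Lp.coeFn_smul c f] with x hx
    rw [hx, Pi.smul_apply, Pi.smul_apply, smul_eq_mul, smul_eq_mul, mul_left_comm]

theorem memLp_of_mem_mulDomain {m : E3 → ℂ} {f : L2} (hf : f ∈ mulDomain m) :
    MemLp (fun x => m x * f x) 2 volume := hf

/-- The maximal (in general unbounded) operator of multiplication by `m` in `L²(ℝ³)`;
its domain consists of all `f ∈ L²` with `m f ∈ L²`. -/
def mulOp (m : E3 → ℂ) : L2 →ₗ.[ℂ] L2 where
  domain := mulDomain m
  toFun :=
    { toFun := fun f => MemLp.toLp (fun x => m x * (f : L2) x) (memLp_of_mem_mulDomain f.2)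
      map_add' := by
        rintro ⟨f, hf⟩ ⟨g, hg⟩
        rw [← MemLp.toLp_add]
        refine MemLp.toLp_congr _ _ ?_
        change (fun x => m x * (f + g : L2) x) =ᵐ[volume] fun x => m x * f x + m x * g x
        filter_upwards [Lp.coeFn_add f g] with x hx
        rw [hx, Pi.add_apply, mul_add]
      map_smul' := by
        rintro c ⟨f, hf⟩
        rw [RingHom.id_apply, ← MemLp.toLp_const_smul]
        refine MemLp.toLp_congr _ _ ?_
        change (fun x => m x * (c • f : L2) x) =ᵐ[volume] fun x => c * (m x * f x)
        filter_upwards [Lp.coeFn_smul c f] with x hx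
        rw [hx, Pi.smul_apply, smul_eq_mul, mul_left_comm] }

/-- The bounded operator of multiplication by an essentially bounded function `m`
(the zero operator if `m` is not essentially bounded). -/
def boundedMulOp (m : E3 → ℂ) : L2 →L[ℂ] L2 :=
  open Classical in
  if h : MemLp m ∞ volume then
    (ContinuousLinearMap.mul ℂ ℂ).holderL volume ∞ 2 2 (h.toLp m)
  else 0

theorem memLp_integral_kernel {k : E3 × E3 → ℂ}
    (hk : MemLp k 2 ((volume : Measure E3).prod volume)) (f : L2) :
    MemLp (fun x => ∫ y, k (x, y) * f y) 2 volume ∧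
      eLpNorm (fun x => ∫ y, k (x, y) * f y) 2 volume ≤
        eLpNorm k 2 ((volume : Measure E3).prod volume) * eLpNorm f 2 volume := by
  have hm : AEStronglyMeasurable (fun x => ∫ y, k (x, y) * f y) (volume : Measure E3) := by
    apply AEStronglyMeasurable.integral_prod_right' (f := fun z : E3 × E3 => k z * f z.2)
    exact hk.1.mul (Lp.aestronglyMeasurable f).comp_snd
  have hk2 : ∫⁻ x : E3, ∫⁻ y : E3, ‖k (x, y)‖ₑ ^ (2 : ℝ) =
      ∫⁻ z, ‖k z‖ₑ ^ (2 : ℝ) ∂((volume : Measure E3).prod volume) :=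
    (lintegral_prod _ (hk.1.enorm.pow_const 2)).symm
  have hpt : ∀ᵐ x : E3, ‖∫ y, k (x, y) * f y‖ₑ ^ (2 : ℝ) ≤
      (∫⁻ y : E3, ‖k (x, y)‖ₑ ^ (2 : ℝ)) * eLpNorm f 2 volume ^ (2 : ℝ) := by
    filter_upwards [hk.1.prodMk_left] with x hx
    have h1 : ‖∫ y, k (x, y) * f y‖ₑ ≤ ∫⁻ y, ‖k (x, y)‖ₑ * ‖f y‖ₑ := by
      refine (enorm_integral_le_lintegral_enorm _).trans_eq ?_
      simp only [enorm_mul]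
    have h2 := ENNReal.lintegral_mul_le_Lp_mul_Lq (volume : Measure E3)
      Real.HolderConjugate.two_two hx.enorm (Lp.aestronglyMeasurable f).enorm
    refine (ENNReal.rpow_le_rpow (h1.trans h2) (by norm_num)).trans_eq ?_
    rw [ENNReal.mul_rpow_of_nonneg _ _ (by norm_num), ← ENNReal.rpow_mul,
      eLpNorm_eq_lintegral_rpow_enorm_toReal (by norm_num) (by norm_num)]
    norm_num
  have key : eLpNorm (fun x => ∫ y, k (x, y) * f y) 2 volume ≤
        eLpNorm k 2 ((volume : Measure E3).prod volume) * eLpNorm f 2 volume := by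
    have h3 : ∫⁻ x : E3, ‖∫ y, k (x, y) * f y‖ₑ ^ (2 : ℝ) ≤
        (∫⁻ z, ‖k z‖ₑ ^ (2 : ℝ) ∂((volume : Measure E3).prod volume)) *
          eLpNorm f 2 volume ^ (2 : ℝ) := by
      refine (lintegral_mono_ae hpt).trans_eq ?_
      rw [lintegral_mul_const' _ _ (ENNReal.rpow_ne_top_of_nonneg (by norm_num)
        (Lp.memLp f).2.ne), hk2]
    have h4 := ENNReal.rpow_le_rpow h3 (z := 1 / 2) (by norm_num)
    rw [ENNReal.mul_rpow_of_nonneg _ _ (by norm_num), ← ENNReal.rpow_mul] at h4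
    rw [eLpNorm_eq_lintegral_rpow_enorm_toReal (p := 2) (f := k) (by norm_num) (by norm_num),
      eLpNorm_eq_lintegral_rpow_enorm_toReal (p := 2) (f := fun x => ∫ y, k (x, y) * f y)
        (by norm_num) (by norm_num)]
    simpa using h4
  exact ⟨⟨hm, key.trans_lt (ENNReal.mul_lt_top hk.2 (Lp.memLp f).2)⟩, key⟩

theorem ae_integrable_kernel {k : E3 × E3 → ℂ}
    (hk : MemLp k 2 ((volume : Measure E3).prod volume)) (f : L2) :
    ∀ᵐ x : E3, Integrable (fun y => k (x, y) * f y) volume := by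
  have h2 : Integrable (fun z => ‖k z‖ ^ 2) ((volume : Measure E3).prod volume) :=
    (memLp_two_iff_integrable_sq_norm hk.1).1 hk
  filter_upwards [h2.prod_right_ae, hk.1.prodMk_left] with x hx hx'
  exact MemLp.integrable_mul ((memLp_two_iff_integrable_sq_norm hx').2 hx) (Lp.memLp f)

/-- The Hilbert-Schmidt operator `(K f)(x) = ∫ k(x, y) f(y) dy` with kernel `k ∈ L²(ℝ³ × ℝ³)`
(the zero operator if `k` is not square integrable). -/
def kernelOp (k : E3 × E3 → ℂ) : L2 →L[ℂ] L2 :=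
  open Classical in
  if hk : MemLp k 2 ((volume : Measure E3).prod volume) then
    LinearMap.mkContinuous
      { toFun := fun f => MemLp.toLp (fun x => ∫ y, k (x, y) * f y) (memLp_integral_kernel hk f).1
        map_add' := by
          intro f g
          rw [← MemLp.toLp_add]
          refine MemLp.toLp_congr _ _ ?_
          filter_upwards [ae_integrable_kernel hk f, ae_integrable_kernel hk g] with x hf hg
          rw [Pi.add_apply, ← integral_add hf hg]
          refine integral_congr_ae ?_
          filter_upwards [Lp.coeFn_add f g] with y hy
          rw [hy, Pi.add_apply, mul_add]
        map_smul' := by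
          intro c f
          rw [RingHom.id_apply, ← MemLp.toLp_const_smul]
          refine MemLp.toLp_congr _ _ (Filter.Eventually.of_forall fun x => ?_)
          rw [Pi.smul_apply, smul_eq_mul, ← integral_const_mul]
          refine integral_congr_ae ?_
          filter_upwards [Lp.coeFn_smul c f] with y hy
          rw [hy, Pi.smul_apply, smul_eq_mul, mul_left_comm] }
      (eLpNorm k 2 ((volume : Measure E3).prod volume)).toReal
      (by
        intro f
        rw [LinearMap.coe_mk, AddHom.coe_mk, Lp.norm_toLp, Lp.norm_def, ← ENNReal.toReal_mul]
        exact ENNReal.toReal_mono (ENNReal.mul_lt_top hk.2 (Lp.memLp f).2).ne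
          (memLp_integral_kernel hk f).2)
  else 0

/-! ### The Hamiltonian and its resolvent -/

theorem exists_bilaplacian (u : L2) (hu : MemSobolev 4 2 (u : 𝓢'(E3, ℂ))) :
    ∃ h : L2, (h : 𝓢'(E3, ℂ)) = Δ (Δ (u : 𝓢'(E3, ℂ))) := by
  have h := hu.laplacian.laplacian
  norm_num at h
  obtain ⟨h, hh⟩ := memSobolev_zero_iff.1 h
  exact ⟨h, hh.symm⟩

theorem toTemperedDistribution_inj {f g : L2} (h : (f : 𝓢'(E3, ℂ)) = (g : 𝓢'(E3, ℂ))) : f = g :=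
  LinearMap.ker_eq_bot.1 (Lp.ker_toTemperedDistributionCLM_eq_bot
    (F := ℂ) (μ := (volume : Measure E3)) (p := 2)) h

theorem toTemperedDistribution_add (f g : L2) :
    ((f + g : L2) : 𝓢'(E3, ℂ)) = (f : 𝓢'(E3, ℂ)) + (g : 𝓢'(E3, ℂ)) :=
  map_add (Lp.toTemperedDistributionCLM ℂ (volume : Measure E3) 2) f g

theorem toTemperedDistribution_smul (c : ℂ) (f : L2) :
    ((c • f : L2) : 𝓢'(E3, ℂ)) = c • (f : 𝓢'(E3, ℂ)) :=
  map_smul (Lp.toTemperedDistributionCLM ℂ (volume : Measure E3) 2) c f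

/-- The Sobolev space `H⁴(ℝ³)` as a subspace of `L²(ℝ³)`. -/
def sobolevH4 : Submodule ℂ L2 where
  carrier := {u | MemSobolev 4 2 (u : 𝓢'(E3, ℂ))}
  add_mem' := by
    intro f g hf hg
    have := MemSobolev.add hf hg
    rwa [← toTemperedDistribution_add] at this
  zero_mem' := by
    have := memSobolev_fun_zero E3 ℂ 4 2
    rwa [← map_zero (Lp.toTemperedDistributionCLM ℂ (volume : Measure E3) 2)] at this
  smul_mem' := by
    intro c f hf
    have := MemSobolev.smul c hf
    rwa [← toTemperedDistribution_smul] at this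

/-- For `u ∈ H⁴(ℝ³)`, the function `Δ² u ∈ L²(ℝ³)` (distributional derivatives). -/
def bilaplacian (u : sobolevH4) : L2 := (exists_bilaplacian u u.2).choose

theorem bilaplacian_spec (u : sobolevH4) :
    (bilaplacian u : 𝓢'(E3, ℂ)) = Δ (Δ ((u : L2) : 𝓢'(E3, ℂ))) :=
  (exists_bilaplacian u u.2).choose_spec

/-- The free operator `H₀ = (-Δ)² = Δ²` in `L²(ℝ³)`, with domain `H⁴(ℝ³)`. -/
def freeHamiltonian : L2 →ₗ.[ℂ] L2 where
  domain := sobolevH4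
  toFun :=
    { toFun := bilaplacian
      map_add' := by
        rintro ⟨f, hf⟩ ⟨g, hg⟩
        apply toTemperedDistribution_inj
        rw [toTemperedDistribution_add, bilaplacian_spec, bilaplacian_spec, bilaplacian_spec]
        simp only [← laplacianCLM_apply]
        rw [← map_add, ← map_add, ← toTemperedDistribution_add]
        rfl
      map_smul' := by
        rintro c ⟨f, hf⟩
        apply toTemperedDistribution_inj
        rw [RingHom.id_apply, toTemperedDistribution_smul, bilaplacian_spec, bilaplacian_spec]
        simp only [← laplacianCLM_apply]
        rw [← map_smul, ← map_smul, ← toTemperedDistribution_smul]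
        rfl }

/-- The operator sum `H = (-Δ)² + V`, with domain `{u ∈ H⁴(ℝ³) | V u ∈ L²(ℝ³)}`
(which is all of `H⁴(ℝ³)` when `V ∈ L²(ℝ³)`, by the Sobolev embedding `H⁴ ⊆ L^∞`). -/
def hamiltonian (V : E3 → ℝ) : L2 →ₗ.[ℂ] L2 :=
  freeHamiltonian + mulOp (fun x => (V x : ℂ))

/-- `z` is in the resolvent set of `T` and the bounded operator `R` is `(T - z)⁻¹`. -/
def IsResolvent (T : L2 →ₗ.[ℂ] L2) (z : ℂ) (R : L2 →L[ℂ] L2) : Prop :=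
  (∀ f : L2, ∃ h : R f ∈ T.domain, T ⟨R f, h⟩ - z • R f = f) ∧
    ∀ u : T.domain, R (T u - z • (u : L2)) = u

/-- The bounded operator `A` is the weighted operator `w R w`: the operator `f ↦ w R (w f)` is
defined for all `f ∈ L²` with `w f ∈ L²`, these `f` are dense in `L²`, and `A` is the bounded
extension of this densely defined operator. -/
def IsWeighted (w : E3 → ℝ) (R A : L2 →L[ℂ] L2) : Prop :=
  Dense ((mulOp (fun x => (w x : ℂ))).domain : Set L2) ∧
    ∀ f : (mulOp (fun x => (w x : ℂ))).domain,
      ∃ h : R (mulOp (fun x => (w x : ℂ)) f) ∈ (mulOp (fun x => (w x : ℂ))).domain,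
        mulOp (fun x => (w x : ℂ)) ⟨R (mulOp (fun x => (w x : ℂ)) f), h⟩ = A f

/-! ### The potential, the projections and the regularity of zero -/

variable (V : E3 → ℝ)

/-- `v = |V|^{1/2}`. -/
def vFun (x : E3) : ℝ := √|V x|

/-- `U = 1` where `V ≥ 0` and `U = -1` where `V < 0`. -/
def uFun (x : E3) : ℝ :=
  open Classical in if 0 ≤ V x then 1 else -1

/-- `w = U v`. -/
def wFun (x : E3) : ℝ := uFun V x * vFun V x

/-- `U` as a multiplication operator. -/
def U : L2 →L[ℂ] L2 := boundedMulOp (fun x => (uFun V x : ℂ))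

/-- `v` as an element of `L²` (zero if `v` is not square integrable). -/
def vVec : L2 :=
  open Classical in
  if h : MemLp (fun x => (vFun V x : ℂ)) 2 volume then h.toLp _ else 0

/-- `α = ‖v‖²`. -/
def α : ℝ := ‖vVec V‖ ^ 2

/-- `P = α⁻¹ ⟨v, ·⟩ v`, the orthogonal projection onto the span of `v`
(`P = 0` when `v = 0`). -/
def P : L2 →L[ℂ] L2 := ((α V : ℂ)⁻¹) • (innerSL ℂ (vVec V)).smulRight (vVec V)

/-- `Q = 1 - P`. -/
def Q : L2 →L[ℂ] L2 := 1 - P V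

/-- The kernel `-|x - y| / (8 π)` of `G₀`. -/
def G₀ (x y : E3) : ℝ := -(‖x - y‖ / (8 * Real.pi))

/-- The operator `v G₀ v`, with kernel `v(x) G₀(x, y) v(y)`. -/
def vG₀v : L2 →L[ℂ] L2 :=
  kernelOp (fun z => ((vFun V z.1 * G₀ z.1 z.2 * vFun V z.2 : ℝ) : ℂ))

/-- The space `Q L²(ℝ³)`. -/
abbrev QL2 : Submodule ℂ L2 := LinearMap.range (Q V : L2 →ₗ[ℂ] L2)

/-- `Q` as a map from `L²` onto `Q L²`. -/
def toQL2 : L2 →L[ℂ] QL2 V := (Q V).codRestrict (QL2 V) fun f => ⟨f, rfl⟩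

/-- `m₀ = Q (U + v G₀ v) Q`, as an operator on `Q L²`. -/
def m₀ : QL2 V →L[ℂ] QL2 V :=
  toQL2 V ∘L (U V + vG₀v V) ∘L Q V ∘L (QL2 V).subtypeL

/-- Zero is a regular point of the spectrum of `H = (-Δ)² + V`: the operator
`Q (U + v G₀ v) Q` is (boundedly) invertible on `Q L²`. -/
def ZeroIsRegular : Prop := IsUnit (m₀ V)

/-- `Q m₀⁻¹ Q` as an operator on `L²`, where `m₀⁻¹` is the inverse on `Q L²`. -/
def Qm₀invQ : L2 →L[ℂ] L2 :=
  (QL2 V).subtypeL ∘L Ring.inverse (m₀ V) ∘L toQL2 V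

/-! ### The coefficients of the expansion -/

/-- `M₀ = U + v G₀ v`, and for `j ≥ 1` the operator `M_j` has the kernel
`-(i^j + (-1)^j) / (8 π (j+2)!) v(x) |x - y|^(j+1) v(y)`; these are the coefficients of `μ^j`,
`j ≥ 0`, in the expansion of `U + v (H₀ - μ⁴)⁻¹ v` at `μ = 0`. -/
def M : ℕ → (L2 →L[ℂ] L2)
  | 0 => U V + vG₀v V
  | j + 1 => kernelOp (fun z =>
      -((Complex.I ^ (j + 1) + (-1) ^ (j + 1)) / (8 * Real.pi * (j + 3).factorial)) *
        ((vFun V z.1 * ‖z.1 - z.2‖ ^ (j + 2) * vFun V z.2 : ℝ) : ℂ))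

/-- The constant `c = (1 + i) α / (8 π)`. -/
def c : ℂ := (1 + Complex.I) * α V / (8 * Real.pi)

/-- The coefficients of the expansion of `(U + v (H₀ - μ⁴)⁻¹ v)⁻¹` in powers of `μ`:
`N₀ = Q m₀⁻¹ Q` and, for `k ≥ 1`,
`N_k = (1 - N₀ M₀) T_k - N₀ ∑_{l < k} M_{k-l} N_l`, where
`T_k = c⁻¹ P (δ_{k,1} - ∑_{l < k} M_{k-1-l} N_l)`. -/
def N : ℕ → (L2 →L[ℂ] L2)
  | 0 => Qm₀invQ V
  | k + 1 =>
      (1 - Qm₀invQ V ∘L M V 0) ∘L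
          ((c V)⁻¹ • (P V ∘L ((if k = 0 then 1 else 0) - ∑ l : Fin (k + 1), M V (k - (l : ℕ)) ∘L N (l : ℕ))))
        - Qm₀invQ V ∘L ∑ l : Fin (k + 1), M V (k + 1 - (l : ℕ)) ∘L N (l : ℕ)
  decreasing_by all_goals exact l.2

/-- The coefficients `M'_j`, `j ≥ 1`, of the expansion of `w (H - μ⁴)⁻¹ w`. -/
def M' (j : ℕ) : L2 →L[ℂ] L2 := -N V j

end FourthOrder

end

/-!
The free resolvent `(Δ² - μ⁴)⁻¹` is the Fourier multiplier with symbol `((2π|ξ|)⁴ - μ⁴)⁻¹`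
(`isResolvent_freeResolvent`). Partial fractions split the symbol into the Fourier transforms of two
Yukawa potentials (`fourier_yukawa`), so the free resolvent is convolution with the bounded,
integrable kernel `(e^{iμr} - e^{-μr}) / (8πμ²r)`, `r = |x - y|` (`coeFn_freeResolvent`). Hence it
maps `L²` to bounded functions, and `v (Δ² - μ⁴)⁻¹`, `(Δ² - μ⁴)⁻¹ v`, `v (Δ² - μ⁴)⁻¹ v` are
Hilbert–Schmidt operators.

By the Birman–Schwinger principle, `μ⁴` is in the resolvent set of `H` whenever
`A(μ) = U + v (Δ² - μ⁴)⁻¹ v` is invertible, with resolvent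
`(Δ² - μ⁴)⁻¹ - (Δ² - μ⁴)⁻¹ v A(μ)⁻¹ v (Δ² - μ⁴)⁻¹`; multiplying by `w` on both sides leaves
`U - A(μ)⁻¹` (`isResolvent_perturbedResolvent`, `isWeighted_perturbedResolvent`). It remains to
expand `A(μ)⁻¹`.

The exponentials in the kernel have exponents in the left half-plane, where the Taylor remainder of
`e^z` is bounded by powers of `|z|`. Together with the decay of `V` this gives
`A(μ) = (c/μ) P + ∑_{j ≤ p} μ^j M_j + O(|μ|^{p + 1/2})` (`exists_norm_sub_expansion_le`). The half
power matters for `p = 0`: the remainder has to tend to zero, while the decay need not suffice for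
the next full power of `|x - y|`.

The inversion is algebra in a Banach algebra (`exists_inverse_expansion`). Multiplication by
`L(μ) = Q + μ c⁻¹ P` from the left removes the pole, and `L(μ) A(μ)` tends to `P + Q M_0`, which is
block triangular with diagonal blocks `1` and `m₀`, hence invertible because zero is a regular
point. The recursion for `N_k` states exactly that the Cauchy product of the coefficients of
`L(μ) A(μ)` with the `N_k` is `L(μ)`, so that `A(μ)⁻¹ = (L(μ) A(μ))⁻¹ L(μ)` agrees with
`∑_{k < p} μ^k N_k` up to `O(μ^p)`.
-/

noncomputable section

namespace FourthOrder

open FourierTransform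

/-! ### Inversion of an operator family with a simple pole -/

section Inversion

variable {𝔸 : Type*} [NormedRing 𝔸] [NormedAlgebra ℂ 𝔸]

/-- The coefficients of the regularized family `(1 - P + μ d P) (c μ⁻¹ P + ∑ μ^j M_j)`, where
`d c P = P`. -/
def regCoeff (P : 𝔸) (d : ℂ) (M : ℕ → 𝔸) : ℕ → 𝔸
  | 0 => P + (1 - P) * M 0
  | k + 1 => d • (P * M k) + (1 - P) * M (k + 1)

/-- The regularization turns `N` into the coefficients of the inverse: the Cauchy product of
`regCoeff` with `N` is `1 - P + μ d P`. -/
theorem sum_regCoeff_mul {P : 𝔸} {d : ℂ} {M N : ℕ → 𝔸} (hP : P * P = P)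
    (hPN : P * N 0 = 0) (h1 : (1 - P) * M 0 * N 0 = 1 - P)
    (hN : ∀ k, N (k + 1) = (1 - N 0 * M 0) * (d • (P * ((if k = 0 then 1 else 0)
        - ∑ l ∈ Finset.range (k + 1), M (k - l) * N l)))
        - N 0 * ∑ l ∈ Finset.range (k + 1), M (k + 1 - l) * N l) (n : ℕ) :
    ∑ l ∈ Finset.range (n + 1), regCoeff P d M (n - l) * N l =
      (if n = 0 then 1 - P else 0) + (if n = 1 then d • P else 0) := by
  have hQP : (1 - P) * P = 0 := by rw [sub_mul, one_mul, hP, sub_self]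
  rcases n with _ | k
  · simp [regCoeff, add_mul, hPN, h1]
  · rw [Finset.sum_range_succ]
    have e1 : ∑ l ∈ Finset.range (k + 1), regCoeff P d M (k + 1 - l) * N l =
        d • (P * ∑ l ∈ Finset.range (k + 1), M (k - l) * N l)
          + (1 - P) * ∑ l ∈ Finset.range (k + 1), M (k + 1 - l) * N l := by
      rw [Finset.mul_sum, Finset.mul_sum, Finset.smul_sum, ← Finset.sum_add_distrib]
      refine Finset.sum_congr rfl fun l hl => ?_
      have : k + 1 - l = (k - l) + 1 := by have := Finset.mem_range.1 hl; omega
      rw [this, regCoeff, add_mul, smul_mul_assoc, mul_assoc, mul_assoc]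
    rw [e1, Nat.sub_self, regCoeff, hN k]
    generalize ∑ l ∈ Finset.range (k + 1), M (k - l) * N l = X
    generalize ∑ l ∈ Finset.range (k + 1), M (k + 1 - l) * N l = Y
    have hT : (P + (1 - P) * M 0) * (1 - N 0 * M 0) * P = P := by
      have : (P + (1 - P) * M 0) * (1 - N 0 * M 0) * P =
          P * P - P * N 0 * (M 0 * P) + (1 - P) * M 0 * P
            - (1 - P) * M 0 * N 0 * (M 0 * P) := by noncomm_ring
      rw [this, hPN, h1, hP]
      noncomm_ring
    have hT2 : (P + (1 - P) * M 0) * N 0 = 1 - P := by rw [add_mul, hPN, h1, zero_add]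
    have e2 : (P + (1 - P) * M 0) * ((1 - N 0 * M 0) * (d • (P * ((if k = 0 then 1 else 0) - X)))
        - N 0 * Y) = d • (P * ((if k = 0 then 1 else 0) - X)) - (1 - P) * Y := by
      rw [mul_sub, ← mul_assoc _ (N 0), hT2, mul_smul_comm, mul_smul_comm, ← mul_assoc,
        ← mul_assoc, hT]
    rw [e2, if_neg (Nat.succ_ne_zero k), mul_sub, smul_sub]
    by_cases hk : k = 0 <;> simp [hk]

theorem norm_sum_smul_le_of_le {ι : Type*} (s : Finset ι) (e : ι → ℕ) (x : ι → 𝔸) {m : ℕ}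
    (he : ∀ i ∈ s, m ≤ e i) {μ : ℂ} (hμ : ‖μ‖ ≤ 1) :
    ‖∑ i ∈ s, μ ^ e i • x i‖ ≤ (∑ i ∈ s, ‖x i‖) * ‖μ‖ ^ m := by
  rw [Finset.sum_mul]
  refine norm_sum_le_of_le _ fun i hi => ?_
  rw [norm_smul, norm_pow, mul_comm]
  exact mul_le_mul_of_nonneg_left (pow_le_pow_of_le_one (norm_nonneg _) hμ (he i hi))
    (norm_nonneg _)

/-- Up to order `μ^p`, the truncated Cauchy product of `regCoeff` and `N` is `1 - P + μ d P`. -/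
theorem exists_norm_sub_truncated_product_le {P : 𝔸} {d : ℂ} {D N : ℕ → 𝔸}
    (h : ∀ n, ∑ l ∈ Finset.range (n + 1), D (n - l) * N l =
      (if n = 0 then 1 - P else 0) + (if n = 1 then d • P else 0)) (p : ℕ) :
    ∃ C : ℝ, ∀ μ : ℂ, ‖μ‖ ≤ 1 →
      ‖(1 - P + (μ * d) • P) - (∑ j ∈ Finset.range (p + 1), μ ^ j • D j) *
        ∑ k ∈ Finset.range p, μ ^ k • N k‖ ≤ C * ‖μ‖ ^ p := by
  set s : Finset (Σ _ : ℕ, ℕ) := (Finset.range p).sigma fun k => Finset.Ico (p - k) (p + 1)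
  set C₁ := ∑ x ∈ s, ‖D x.2 * N x.1‖
  have key : ∀ μ : ℂ, (∑ j ∈ Finset.range (p + 1), μ ^ j • D j) *
        ∑ k ∈ Finset.range p, μ ^ k • N k =
      ∑ n ∈ Finset.range p, μ ^ n • ((if n = 0 then 1 - P else 0) + (if n = 1 then d • P else 0))
        + ∑ x ∈ s, μ ^ (x.1 + x.2) • (D x.2 * N x.1) := by
    intro μ
    have h1 : ∑ n ∈ Finset.range p,
        μ ^ n • ((if n = 0 then 1 - P else 0) + (if n = 1 then d • P else 0)) =
        ∑ k ∈ Finset.range p, ∑ j ∈ Finset.range (p - k), μ ^ (k + j) • (D j * N k) := by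
      rw [← Finset.sum_range_diag_flip p fun k j => μ ^ (k + j) • (D j * N k)]
      refine Finset.sum_congr rfl fun n _ => ?_
      rw [← h n, Finset.smul_sum]
      refine Finset.sum_congr rfl fun l hl => ?_
      rw [Nat.add_sub_cancel' (Nat.lt_succ_iff.1 (Finset.mem_range.1 hl))]
    rw [h1, Finset.sum_sigma, ← Finset.sum_add_distrib, Finset.sum_mul_sum, Finset.sum_comm]
    refine Finset.sum_congr rfl fun k hk => ?_
    rw [Finset.range_eq_Ico, Finset.range_eq_Ico,
      Finset.sum_Ico_consecutive _ (Nat.zero_le _) (by omega)]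
    refine Finset.sum_congr rfl fun j _ => ?_
    rw [smul_mul_smul_comm, ← pow_add, add_comm k]
  have key2 : ∃ C₂ : ℝ, ∀ μ : ℂ, ‖μ‖ ≤ 1 → ‖(1 - P + (μ * d) • P) - ∑ n ∈ Finset.range p,
      μ ^ n • ((if n = 0 then 1 - P else 0) + (if n = 1 then d • P else 0))‖
        ≤ C₂ * ‖μ‖ ^ p := by
    rcases p with _ | _ | p
    · refine ⟨‖(1 : 𝔸) - P‖ + ‖d • P‖, fun μ hμ => ?_⟩
      rw [Finset.range_zero, Finset.sum_empty, sub_zero, pow_zero, mul_one, mul_smul]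
      refine (norm_add_le _ _).trans (add_le_add le_rfl ?_)
      rw [norm_smul]
      exact mul_le_of_le_one_left (norm_nonneg _) hμ
    · refine ⟨‖d • P‖, fun μ hμ => ?_⟩
      rw [zero_add, pow_one, Finset.sum_range_one, if_pos rfl, if_neg zero_ne_one, add_zero,
        pow_zero, one_smul, add_sub_cancel_left, mul_smul, norm_smul, mul_comm]
    · refine ⟨0, fun μ hμ => ?_⟩
      rw [Finset.sum_range_succ', Finset.sum_range_succ', Finset.sum_eq_zero]
      · simp [mul_smul, add_comm]
      · intro n _
        simp
  obtain ⟨C₂, hC₂⟩ := key2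
  refine ⟨C₂ + C₁, fun μ hμ => ?_⟩
  rw [key, ← sub_sub, add_mul]
  refine (norm_sub_le _ _).trans (add_le_add (hC₂ μ hμ) ?_)
  refine norm_sum_smul_le_of_le s _ _ (fun x hx => ?_) hμ
  have := Finset.mem_Ico.1 (Finset.mem_sigma.1 hx).2
  omega

variable [CompleteSpace 𝔸]

/-- If the compression of `M 0` to the range of `1 - P` is invertible with inverse `N 0`, then a
family `A = c μ⁻¹ P + ∑_{j ≤ p} μ^j M_j + o(μ^p)` is invertible for small `μ ≠ 0`, and its inverse
has an expansion up to order `μ^p` with the coefficients `N k`. The factor `1 - P + μ d P` removes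
the pole: its product with `A` tends to the invertible element `P + (1 - P) M_0`. -/
theorem exists_inverse_expansion {P : 𝔸} {c d : ℂ} {M N : ℕ → 𝔸} (hP : P * P = P)
    (hcd : (d * c) • P = P) (hPN : P * N 0 = 0) (hNP : N 0 * P = 0)
    (h1 : (1 - P) * M 0 * N 0 = 1 - P) (h2 : N 0 * M 0 * (1 - P) = 1 - P)
    (hN : ∀ k, N (k + 1) = (1 - N 0 * M 0) * (d • (P * ((if k = 0 then 1 else 0)
        - ∑ l ∈ Finset.range (k + 1), M (k - l) * N l)))
        - N 0 * ∑ l ∈ Finset.range (k + 1), M (k + 1 - l) * N l) (p : ℕ) (K : ℝ) :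
    ∃ μ₀ : ℝ, 0 < μ₀ ∧ ∃ C : ℝ, ∀ μ : ℂ, μ ≠ 0 → ‖μ‖ ≤ μ₀ → ∀ A : 𝔸,
      ‖A - ((c * μ⁻¹) • P + ∑ j ∈ Finset.range (p + 1), μ ^ j • M j)‖
        ≤ K * (‖μ‖ ^ p * √‖μ‖) →
      ∃ B : 𝔸, A * B = 1 ∧ B * A = 1 ∧
        ‖B - ∑ k ∈ Finset.range p, μ ^ k • N k‖ ≤ C * ‖μ‖ ^ p := by
  have hQP : (1 - P) * P = 0 := by rw [sub_mul, one_mul, hP, sub_self]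
  have hPQ : P * (1 - P) = 0 := by rw [mul_sub, mul_one, hP, sub_self]
  have hQQ : (1 - P) * (1 - P) = 1 - P := by rw [mul_sub, hQP, mul_one, sub_zero]
  set D := regCoeff P d M with hD
  have hT1 : D 0 * ((1 - N 0 * M 0) * P + N 0) = 1 := by
    have : (P + (1 - P) * M 0) * ((1 - N 0 * M 0) * P + N 0) =
        P * P - P * N 0 * (M 0 * P) + (1 - P) * M 0 * P
          - (1 - P) * M 0 * N 0 * (M 0 * P) + P * N 0 + (1 - P) * M 0 * N 0 := by noncomm_ring
    rw [hD, regCoeff, this, hPN, h1, hP]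
    noncomm_ring
  have hT2 : ((1 - N 0 * M 0) * P + N 0) * D 0 = 1 := by
    have : ((1 - N 0 * M 0) * P + N 0) * (P + (1 - P) * M 0) =
        P * P - N 0 * M 0 * (P * P) + (P - P * P) * M 0
          - N 0 * M 0 * (P - P * P) * M 0 + N 0 * P + N 0 * M 0 - N 0 * P * M 0 := by
      noncomm_ring
    have h3 : N 0 * M 0 * P = N 0 * M 0 - (1 - P) := by
      rw [← h2, mul_sub, mul_one, sub_sub_cancel]
    rw [hD, regCoeff, this, hNP, hP, h3]
    noncomm_ring
  obtain ⟨T, hT⟩ : IsUnit (D 0) := ⟨⟨_, _, hT1, hT2⟩, rfl⟩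
  -- By continuity of the inverse, elements near `D 0` have uniformly bounded inverses.
  obtain ⟨δ, hδ, hball⟩ : ∃ δ > 0, ∀ Y : 𝔸, ‖Y - D 0‖ < δ →
      IsUnit Y ∧ ‖Ring.inverse Y‖ ≤ ‖Ring.inverse (D 0)‖ + 1 := by
    have e1 : ∀ᶠ Y in nhds (D 0), IsUnit Y := hT ▸ Units.nhds T
    have e2 : ∀ᶠ Y in nhds (D 0), ‖Ring.inverse Y‖ < ‖Ring.inverse (D 0)‖ + 1 := by
      have := (hT ▸ NormedRing.inverse_continuousAt T : ContinuousAt Ring.inverse (D 0)).norm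
      exact this.eventually (gt_mem_nhds (lt_add_one _))
    obtain ⟨δ, hδ, h⟩ := Metric.eventually_nhds_iff.1 (e1.and e2)
    exact ⟨δ, hδ, fun Y hY => ⟨(h (by rwa [dist_eq_norm])).1, (h (by rwa [dist_eq_norm])).2.le⟩⟩
  obtain ⟨C₁, hC₁⟩ := exists_norm_sub_truncated_product_le (sum_regCoeff_mul hP hPN h1 hN) p
  set a := ‖(1 : 𝔸) - P‖ + ‖d • P‖
  set b := a * |K| + ‖d • (P * M p)‖
  set s := ∑ j ∈ Finset.Ico 1 (p + 1), ‖D j‖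
  set t := ∑ k ∈ Finset.range p, ‖N k‖
  have ha : 0 ≤ a := by positivity
  have hb : 0 ≤ b := by positivity
  have hs : 0 ≤ s := Finset.sum_nonneg fun _ _ => norm_nonneg _
  refine ⟨min 1 ((δ / (b + s + 1)) ^ 2 / 2), by positivity,
    (‖Ring.inverse (D 0)‖ + 1) * (C₁ + b * t), fun μ hμ0 hμ A hA => ?_⟩
  have hμ1 : ‖μ‖ ≤ 1 := hμ.trans (min_le_left _ _)
  have hsq1 : √‖μ‖ ≤ 1 := Real.sqrt_le_one.2 hμ1
  have hμsq : ‖μ‖ ≤ √‖μ‖ := by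
    conv_lhs => rw [← Real.mul_self_sqrt (norm_nonneg μ)]
    exact mul_le_of_le_one_left (Real.sqrt_nonneg _) hsq1
  have hsqδ : √‖μ‖ < δ / (b + s + 1) := by
    rw [Real.sqrt_lt' (by positivity)]
    have h3 : (0 : ℝ) < (δ / (b + s + 1)) ^ 2 := by positivity
    exact (hμ.trans (min_le_right _ _)).trans_lt (half_lt_self h3)
  set L : 𝔸 := 1 - P + (μ * d) • P with hL
  set L' : 𝔸 := 1 - P + (μ⁻¹ * c) • P with hL'
  have hLn : ‖L‖ ≤ a := by
    rw [hL, mul_smul]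
    refine (norm_add_le _ _).trans (add_le_add le_rfl ?_)
    rw [norm_smul]
    exact mul_le_of_le_one_left (norm_nonneg _) hμ1
  have hLL' : L' * L = 1 := by
    rw [hL, hL', add_mul, mul_add, mul_add, hQQ, mul_smul_comm, hQP, smul_mul_assoc, hPQ,
      smul_mul_smul_comm, hP]
    have : μ⁻¹ * c * (μ * d) = d * c := by field_simp
    rw [this, hcd]
    simp
  set E := A - ((c * μ⁻¹) • P + ∑ j ∈ Finset.range (p + 1), μ ^ j • M j) with hE
  set X := ∑ j ∈ Finset.range (p + 1), μ ^ j • D j with hX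
  set S := ∑ k ∈ Finset.range p, μ ^ k • N k with hS
  have hLA : L * A = X + (μ ^ (p + 1) • (d • (P * M p)) + L * E) := by
    have e1 : A = (c * μ⁻¹) • P + ∑ j ∈ Finset.range (p + 1), μ ^ j • M j + E := by
      rw [hE]; abel
    have e2 : L * ((c * μ⁻¹) • P) = P := by
      rw [hL, add_mul, mul_smul_comm, hQP, smul_mul_smul_comm, hP, smul_zero, zero_add]
      have : μ * d * (c * μ⁻¹) = d * c := by field_simp
      rw [this, hcd]
    have e3 : P + L * ∑ j ∈ Finset.range (p + 1), μ ^ j • M j =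
        X + μ ^ (p + 1) • (d • (P * M p)) := by
      have f1 : X = P + ∑ j ∈ Finset.range (p + 1), μ ^ j • ((1 - P) * M j)
          + ∑ j ∈ Finset.range p, μ ^ (j + 1) • (d • (P * M j)) := by
        rw [hX, Finset.sum_range_succ', Finset.sum_range_succ' (fun j => μ ^ j • ((1 - P) * M j))]
        simp only [hD, regCoeff, pow_zero, one_smul, smul_add, Finset.sum_add_distrib]
        abel
      rw [f1, add_assoc _ _ (μ ^ (p + 1) • _),
        ← Finset.sum_range_succ (fun j => μ ^ (j + 1) • (d • (P * M j))), hL, add_mul, add_assoc]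
      congr 2
      · rw [Finset.mul_sum]
        exact Finset.sum_congr rfl fun j _ => mul_smul_comm _ _ _
      · rw [Finset.mul_sum]
        refine Finset.sum_congr rfl fun j _ => ?_
        rw [smul_mul_smul_comm, smul_smul]
        congr 1
        ring
    rw [e1, mul_add, mul_add, e2, e3, add_assoc]
  set F := μ ^ (p + 1) • (d • (P * M p)) + L * E with hF
  have hFn : ‖F‖ ≤ b * (‖μ‖ ^ p * √‖μ‖) := by
    have f1 : ‖L * E‖ ≤ a * |K| * (‖μ‖ ^ p * √‖μ‖) := by
      refine (norm_mul_le _ _).trans ?_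
      rw [mul_assoc]
      exact mul_le_mul hLn (hA.trans (mul_le_mul_of_nonneg_right (le_abs_self K) (by positivity)))
        (norm_nonneg _) ha
    have f2 : ‖μ ^ (p + 1) • (d • (P * M p))‖ ≤ ‖d • (P * M p)‖ * (‖μ‖ ^ p * √‖μ‖) := by
      rw [norm_smul, norm_pow, pow_succ, mul_comm]
      gcongr
    refine (norm_add_le _ _).trans ((add_le_add f2 f1).trans_eq ?_)
    simp only [b]; ring
  have hXn : ‖X - D 0‖ ≤ s * √‖μ‖ := by
    have : X - D 0 = ∑ j ∈ Finset.Ico 1 (p + 1), μ ^ j • D j := by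
      rw [hX, Finset.range_eq_Ico, Finset.sum_eq_sum_Ico_succ_bot (Nat.succ_pos p)]
      simp
    rw [this]
    refine (norm_sum_smul_le_of_le _ (fun j => j) D (m := 1)
      (fun j hj => (Finset.mem_Ico.1 hj).1) hμ1).trans ?_
    rw [pow_one]
    gcongr
  have hclose : ‖L * A - D 0‖ < δ := by
    have : L * A - D 0 = (X - D 0) + F := by rw [hLA]; abel
    rw [this]
    have hp1 : ‖μ‖ ^ p ≤ 1 := pow_le_one₀ (norm_nonneg _) hμ1
    calc ‖(X - D 0) + F‖ ≤ s * √‖μ‖ + b * (‖μ‖ ^ p * √‖μ‖) :=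
          (norm_add_le _ _).trans (add_le_add hXn hFn)
      _ ≤ s * √‖μ‖ + b * (1 * √‖μ‖) := by gcongr
      _ ≤ (b + s + 1) * √‖μ‖ := by nlinarith [Real.sqrt_nonneg ‖μ‖]
      _ < δ := by rw [lt_div_iff₀ (by positivity)] at hsqδ; linarith
  obtain ⟨hunit, hinv⟩ := hball _ hclose
  set G := Ring.inverse (L * A)
  have hG1 : L * A * G = 1 := Ring.mul_inverse_cancel _ hunit
  have hG2 : G * (L * A) = 1 := Ring.inverse_mul_cancel _ hunit
  refine ⟨G * L, ?_, by rw [mul_assoc, hG2], ?_⟩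
  · calc A * (G * L) = L' * L * A * (G * L) := by rw [hLL', one_mul]
      _ = L' * (L * A * G) * L := by noncomm_ring
      _ = 1 := by rw [hG1, mul_one, hLL']
  · have e1 : G * L - S = G * ((L - X * S) - F * S) := by
      have : S = G * (L * A) * S := by rw [hG2, one_mul]
      conv_lhs => rw [this, hLA]
      noncomm_ring
    have hSn : ‖S‖ ≤ t := by
      have := norm_sum_smul_le_of_le (Finset.range p) (fun k => k) N (m := 0)
        (fun _ _ => Nat.zero_le _) hμ1
      simpa using this
    rw [e1]
    calc ‖G * ((L - X * S) - F * S)‖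
        ≤ ‖G‖ * ‖(L - X * S) - F * S‖ := norm_mul_le _ _
      _ ≤ (‖Ring.inverse (D 0)‖ + 1) * (C₁ * ‖μ‖ ^ p + b * (‖μ‖ ^ p * 1) * t) := by
          refine mul_le_mul hinv ?_ (norm_nonneg _) (by positivity)
          refine (norm_sub_le _ _).trans (add_le_add (hC₁ μ hμ1) ((norm_mul_le _ _).trans ?_))
          refine mul_le_mul (hFn.trans ?_) hSn (norm_nonneg _) (by positivity)
          gcongr
      _ = _ := by ring

end Inversion

/-! ### The Fourier transform of the Yukawa potential -/

/-- The Yukawa potential `e^{-a|x|} / |x|` in three dimensions, with a complex parameter `a`. -/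
def yukawa (a : ℂ) (x : E3) : ℂ := Complex.exp (-a * ‖x‖) / ‖x‖

theorem integrable_yukawa {a : ℂ} (ha : 0 < a.re) : Integrable (yukawa a) := by
  refine (integrable_fun_norm_addHaar (volume : Measure E3)
    (f := fun r : ℝ => Complex.exp (-a * r) / (r : ℂ))).2 ?_
  have h := integrableOn_rpow_mul_exp_neg_mul_rpow (s := 1) (p := 1) (b := a.re)
    (by norm_num) one_pos ha
  refine Integrable.mono' h ?_ ?_
  · refine ContinuousOn.aestronglyMeasurable (fun x hx => ContinuousAt.continuousWithinAt ?_)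
      measurableSet_Ioi
    have : (x : ℂ) ≠ 0 := Complex.ofReal_ne_zero.2 (ne_of_gt hx)
    fun_prop (disch := assumption)
  · refine (ae_restrict_iff' measurableSet_Ioi).2 (Filter.Eventually.of_forall fun r hr => ?_)
    have hr' : 0 < r := hr
    rw [finrank_euclideanSpace_fin, norm_smul, norm_div, Complex.norm_exp, Complex.norm_real,
      Real.norm_of_nonneg hr'.le, Real.norm_of_nonneg (by positivity), Real.rpow_one]
    refine le_of_eq ?_
    have : (-a * (r : ℂ)).re = -a.re * r := by simp
    rw [this]
    field_simp

/-- Integration of the Yukawa potential over an affine plane at distance `|t|` from the origin: in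
polar coordinates of the plane the integrand is an exact derivative. -/
theorem integral_plane_yukawa {a : ℂ} (ha : 0 < a.re) {t : ℝ} (ht : t ≠ 0) :
    ∫ y : EuclideanSpace ℝ (Fin 2), Complex.exp (-a * (√(t ^ 2 + ‖y‖ ^ 2) : ℝ))
        / (√(t ^ 2 + ‖y‖ ^ 2) : ℝ) = 2 * Real.pi / a * Complex.exp (-a * (|t| : ℝ)) := by
  have ha0 : a ≠ 0 := fun h => by simp [h] at ha
  have hpos : ∀ r : ℝ, 0 < t ^ 2 + r ^ 2 := fun r => by positivity
  rw [integral_fun_norm_addHaar (volume : Measure (EuclideanSpace ℝ (Fin 2)))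
    (fun r : ℝ => Complex.exp (-a * (√(t ^ 2 + r ^ 2) : ℝ)) / (√(t ^ 2 + r ^ 2) : ℝ))]
  have hderiv : ∀ r ∈ Set.Ici (0 : ℝ), HasDerivAt
      (fun r : ℝ => -(Complex.exp (-a * (√(t ^ 2 + r ^ 2) : ℝ)) / a))
      (r ^ 1 • (Complex.exp (-a * (√(t ^ 2 + r ^ 2) : ℝ)) / (√(t ^ 2 + r ^ 2) : ℝ))) r := by
    intro r _
    have h1 : HasDerivAt (fun r : ℝ => √(t ^ 2 + r ^ 2)) (r / √(t ^ 2 + r ^ 2)) r := by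
      convert! (((hasDerivAt_pow 2 r).const_add (t ^ 2)).sqrt (hpos r).ne') using 1
      field_simp
      simp [mul_comm]
    have h2 := (((h1.ofReal_comp.const_mul (-a)).cexp).div_const a).neg
    convert! h2 using 1
    rw [pow_one, Complex.real_smul]
    push_cast
    field_simp
  have hint : IntegrableOn (fun r : ℝ =>
      r ^ 1 • (Complex.exp (-a * (√(t ^ 2 + r ^ 2) : ℝ)) / (√(t ^ 2 + r ^ 2) : ℝ)))
      (Set.Ioi 0) := by
    refine Integrable.mono' (integrableOn_exp_mul_Ioi (a := -a.re) (by linarith) 0) ?_ ?_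
    · refine Continuous.aestronglyMeasurable ?_
      have : ∀ r : ℝ, ((√(t ^ 2 + r ^ 2) : ℝ) : ℂ) ≠ 0 := fun r =>
        Complex.ofReal_ne_zero.2 (Real.sqrt_pos.2 (hpos r)).ne'
      fun_prop (disch := assumption)
    · refine (ae_restrict_iff' measurableSet_Ioi).2 (Filter.Eventually.of_forall fun r hr => ?_)
      have hr' : 0 < r := hr
      have hle : r ≤ √(t ^ 2 + r ^ 2) := Real.le_sqrt_of_sq_le (by nlinarith [sq_nonneg t])
      have hsq : 0 < √(t ^ 2 + r ^ 2) := Real.sqrt_pos.2 (hpos r)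
      rw [pow_one, norm_smul, norm_div, Complex.norm_exp, Complex.norm_real,
        Real.norm_of_nonneg hr'.le, Real.norm_of_nonneg hsq.le]
      have : (-a * ((√(t ^ 2 + r ^ 2) : ℝ) : ℂ)).re = -a.re * √(t ^ 2 + r ^ 2) := by simp
      rw [this, mul_div_assoc', div_le_iff₀ hsq, mul_comm]
      refine mul_le_mul (Real.exp_le_exp.2 ?_) hle hr'.le (Real.exp_pos _).le
      nlinarith
  have hlim : Filter.Tendsto (fun r : ℝ => -(Complex.exp (-a * (√(t ^ 2 + r ^ 2) : ℝ)) / a))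
      Filter.atTop (nhds (-(0 / a))) := by
    refine (Filter.Tendsto.div_const ?_ a).neg
    rw [Complex.tendsto_exp_nhds_zero_iff]
    have e1 : ∀ r : ℝ, (-a * ((√(t ^ 2 + r ^ 2) : ℝ) : ℂ)).re = -a.re * √(t ^ 2 + r ^ 2) := by
      intro r; simp
    simp_rw [e1]
    refine Filter.Tendsto.const_mul_atTop_of_neg (by linarith) ?_
    refine Filter.tendsto_atTop_mono (fun r => ?_) Filter.tendsto_id
    exact Real.le_sqrt_of_sq_le (by simp only [id]; nlinarith [sq_nonneg t])
  rw [finrank_euclideanSpace_fin, integral_Ioi_of_hasDerivAt_of_tendsto' hderiv hint hlim]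
  have hball : (volume : Measure (EuclideanSpace ℝ (Fin 2))).real (Metric.ball 0 1) = Real.pi := by
    simp [Measure.real, Real.pi_pos.le]
  have hsqrt : √(t ^ 2 + 0 ^ 2) = |t| := by simp [Real.sqrt_sq_eq_abs]
  rw [hball, hsqrt]
  simp only [zero_div, neg_zero, zero_sub, neg_neg, Complex.real_smul, nsmul_eq_mul]
  push_cast
  ring

theorem integral_character_mul_exp_neg_abs {a : ℂ} (ha : 0 < a.re) (s : ℝ) :
    ∫ t : ℝ, Complex.exp (-(2 * Real.pi * s * t : ℝ) * Complex.I)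
      * Complex.exp (-a * (|t| : ℝ)) = 2 * a / (a ^ 2 + (2 * Real.pi * s : ℝ) ^ 2) := by
  set b : ℂ := (2 * Real.pi * s : ℝ) * Complex.I with hb
  have hbre : b.re = 0 := by simp [hb]
  have e1 : ∀ t ∈ Set.Iic (0 : ℝ), Complex.exp (-(2 * Real.pi * s * t : ℝ) * Complex.I)
      * Complex.exp (-a * (|t| : ℝ)) = Complex.exp ((a - b) * t) := by
    intro t ht
    rw [abs_of_nonpos ht, ← Complex.exp_add, hb]
    congr 1; push_cast; ring
  have e2 : ∀ t ∈ Set.Ioi (0 : ℝ), Complex.exp (-(2 * Real.pi * s * t : ℝ) * Complex.I)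
      * Complex.exp (-a * (|t| : ℝ)) = Complex.exp ((-a - b) * t) := by
    intro t ht
    rw [abs_of_pos ht, ← Complex.exp_add, hb]
    congr 1; push_cast; ring
  have i1 : 0 < (a - b).re := by simpa [hbre] using ha
  have i2 : (-a - b).re < 0 := by simpa [hbre] using ha
  have n1 : a - b ≠ 0 := fun h => by simp [h] at i1
  have n2 : -a - b ≠ 0 := fun h => by simp [h] at i2
  have hfac : a ^ 2 + ((2 * Real.pi * s : ℝ) : ℂ) ^ 2 = -((a - b) * (-a - b)) := by
    have : b ^ 2 = -((2 * Real.pi * s : ℝ) : ℂ) ^ 2 := by rw [hb, mul_pow, Complex.I_sq]; ring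
    linear_combination this
  rw [← intervalIntegral.integral_Iic_add_Ioi (b := 0), setIntegral_congr_fun measurableSet_Iic e1,
    setIntegral_congr_fun measurableSet_Ioi e2, integral_exp_mul_complex_Iic i1,
    integral_exp_mul_complex_Ioi i2, hfac]
  · simp only [Complex.ofReal_zero, mul_zero, Complex.exp_zero]
    field_simp
    ring
  · exact (integrableOn_exp_mul_complex_Iic i1 0).congr_fun (fun t ht => (e1 t ht).symm)
      measurableSet_Iic
  · exact (integrableOn_exp_mul_complex_Ioi i2 0).congr_fun (fun t ht => (e2 t ht).symm)
      measurableSet_Ioi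

/-- The splitting `ℝ³ = ℝ × ℝ²` into the first coordinate and the other two. -/
def splitE3 (x : E3) : ℝ × EuclideanSpace ℝ (Fin 2) := (x 0, !₂[x 1, x 2])

theorem norm_eq_sqrt_splitE3 (x : E3) :
    ‖x‖ = √((splitE3 x).1 ^ 2 + ‖(splitE3 x).2‖ ^ 2) := by
  rw [EuclideanSpace.norm_eq, EuclideanSpace.norm_sq_eq, Fin.sum_univ_three, Fin.sum_univ_two]
  simp [splitE3, add_assoc]

theorem measurePreserving_splitE3 : MeasurePreserving splitE3 volume (volume.prod volume) := by
  have h1 := PiLp.volume_preserving_ofLp (Fin 3)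
  have h2 := volume_preserving_piFinSuccAbove (fun _ : Fin 3 => ℝ) 0
  have h3 := (MeasurePreserving.id (volume : Measure ℝ)).prod (PiLp.volume_preserving_toLp (Fin 2))
  have h := h3.comp (h2.comp h1)
  convert! h using 1
  ext x i
  · rfl
  · fin_cases i <;> rfl

theorem measurableEmbedding_splitE3 : MeasurableEmbedding splitE3 := by
  refine measurePreserving_splitE3.measurable.measurableEmbedding fun x y h => ?_
  have h0 := congrArg Prod.fst h
  have h1 := congrArg (fun z => z.2 0) h
  have h2 := congrArg (fun z => z.2 1) h
  ext i
  fin_cases i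
  · exact h0
  · exact h1
  · exact h2

/-- The Fourier transform of the Yukawa potential. By rotation invariance it suffices to treat
frequencies along the first coordinate axis, where the integral can be taken over planes
perpendicular to the axis first. -/
theorem fourier_yukawa {a : ℂ} (ha : 0 < a.re) (ξ : E3) :
    𝓕 (yukawa a) ξ = 4 * Real.pi / (a ^ 2 + (2 * Real.pi * ‖ξ‖ : ℝ) ^ 2) := by
  set w : E3 := EuclideanSpace.single 0 ‖ξ‖ with hw
  have hnorm : ‖w‖ = ‖ξ‖ := by simp [hw]
  have hrot : 𝓕 (yukawa a) ξ = 𝓕 (yukawa a) w := by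
    set A : E3 ≃ₗᵢ[ℝ] E3 := Submodule.reflection (Submodule.span ℝ {w - ξ})ᗮ with hA
    have hAw : A w = ξ := Submodule.reflection_sub hnorm
    have hcomp : yukawa a ∘ A = yukawa a := by
      ext x; simp [yukawa, Function.comp_apply]
    rw [← hAw, ← Real.fourier_comp_linearIsometry, hcomp]
  set g : ℝ × EuclideanSpace ℝ (Fin 2) → ℂ := fun z =>
    Complex.exp (-(2 * Real.pi * ‖ξ‖ * z.1 : ℝ) * Complex.I) *
      (Complex.exp (-a * (√(z.1 ^ 2 + ‖z.2‖ ^ 2) : ℝ)) / (√(z.1 ^ 2 + ‖z.2‖ ^ 2) : ℝ)) with hg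
  have hgx : ∀ x : E3, Complex.exp (((-2 * Real.pi * inner ℝ x w : ℝ) : ℂ) * Complex.I) •
      yukawa a x = g (splitE3 x) := by
    intro x
    have hin : inner ℝ x w = ‖ξ‖ * x 0 := by
      rw [hw, EuclideanSpace.inner_single_right]
      simp
    simp only [hg]
    rw [← norm_eq_sqrt_splitE3, hin, smul_eq_mul, yukawa]
    congr 3
    simp only [splitE3]
    push_cast; ring
  have hgint : Integrable g (volume.prod volume) := by
    rw [← measurePreserving_splitE3.integrable_comp_emb measurableEmbedding_splitE3]
    have : g ∘ splitE3 = fun x : E3 =>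
        Complex.exp (((-2 * Real.pi * inner ℝ x w : ℝ) : ℂ) * Complex.I) • yukawa a x :=
      funext fun x => (hgx x).symm
    rw [this]
    refine ((integrable_yukawa ha).bdd_mul (c := 1) ?_ ?_)
    · exact (by fun_prop : Continuous fun x : E3 =>
        Complex.exp (((-2 * Real.pi * inner ℝ x w : ℝ) : ℂ) * Complex.I)).aestronglyMeasurable
    · exact Filter.Eventually.of_forall fun x => (Complex.norm_exp_ofReal_mul_I _).le
  rw [hrot, Real.fourier_eq']
  simp_rw [hgx]
  rw [measurePreserving_splitE3.integral_comp measurableEmbedding_splitE3, integral_prod g hgint]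
  have hae : ∀ᵐ t : ℝ, ∫ y : EuclideanSpace ℝ (Fin 2), g (t, y) =
      2 * Real.pi / a * (Complex.exp (-(2 * Real.pi * ‖ξ‖ * t : ℝ) * Complex.I)
        * Complex.exp (-a * (|t| : ℝ))) := by
    filter_upwards [Measure.ae_ne volume (0 : ℝ)] with t ht
    simp only [hg]
    rw [integral_const_mul, integral_plane_yukawa ha ht]
    ring
  rw [integral_congr_ae hae, integral_const_mul, integral_character_mul_exp_neg_abs ha]
  have ha0 : a ≠ 0 := fun h => by simp [h] at ha
  field_simp
  ring

/-! ### The free resolvent as a Fourier multiplier -/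

/-- The symbol `(2π|ξ|)⁴` of `Δ²`. -/
def bilaplaceSymbol (ξ : E3) : ℝ := (2 * Real.pi) ^ 4 * (‖ξ‖ ^ 2) ^ 2

/-- The symbol `((2π|ξ|)⁴ - z)⁻¹` of the free resolvent. -/
def resolventSymbol (z : ℂ) (ξ : E3) : ℂ := ((bilaplaceSymbol ξ : ℂ) - z)⁻¹

theorem bilaplaceSymbol_nonneg (ξ : E3) : 0 ≤ bilaplaceSymbol ξ := by
  unfold bilaplaceSymbol; positivity

theorem hasTemperateGrowth_bilaplaceSymbol : Function.HasTemperateGrowth bilaplaceSymbol := by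
  unfold bilaplaceSymbol; fun_prop

/-- A point off the half-line `[0, ∞)` has positive distance to it. -/
theorem exists_pos_le_norm_sub {z : ℂ} (hz : ∀ t : ℝ, 0 ≤ t → (t : ℂ) ≠ z) :
    ∃ d : ℝ, 0 < d ∧ ∀ t : ℝ, 0 ≤ t → d ≤ ‖(t : ℂ) - z‖ := by
  have hcl : IsClosed (Complex.ofReal '' Set.Ici 0) :=
    Complex.isometry_ofReal.isClosedEmbedding.isClosedMap _ isClosed_Ici
  have hne : (Complex.ofReal '' Set.Ici 0).Nonempty := ⟨_, 0, Set.self_mem_Ici, rfl⟩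
  refine ⟨Metric.infDist z (Complex.ofReal '' Set.Ici 0), ?_, fun t ht => ?_⟩
  · refine (hcl.notMem_iff_infDist_pos hne).1 ?_
    rintro ⟨t, ht, h⟩
    exact hz t ht h
  · rw [← dist_eq_norm, dist_comm]
    exact Metric.infDist_le_dist_of_mem ⟨t, ht, rfl⟩

theorem iteratedDerivWithin_inv_sub {z : ℂ} (hz : ∀ t : ℝ, 0 ≤ t → (t : ℂ) ≠ z) (n : ℕ) :
    ∀ t ∈ Set.Ici (0 : ℝ), iteratedDerivWithin n (fun s : ℝ => ((s : ℂ) - z)⁻¹) (Set.Ici 0) t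
      = (-1) ^ n * n.factorial * (((t : ℂ) - z)⁻¹) ^ (n + 1) := by
  induction n with
  | zero => intro t _; simp
  | succ n ih =>
    intro t ht
    rw [iteratedDerivWithin_succ, derivWithin_congr ih (ih t ht)]
    have hne : (t : ℂ) - z ≠ 0 := sub_ne_zero.2 (hz t ht)
    have h1 : HasDerivAt (fun s : ℝ => (s : ℂ) - z) 1 t :=
      (Complex.ofRealCLM.hasDerivAt (x := t)).sub_const z
    have h2 := ((h1.inv hne).pow (n + 1)).const_mul ((-1 : ℂ) ^ n * n.factorial)
    refine (h2.hasDerivWithinAt.derivWithin (uniqueDiffOn_Ici 0 t ht)).trans ?_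
    rw [Nat.factorial_succ]
    push_cast
    simp only [Pi.inv_apply, inv_pow]
    generalize (t : ℂ) - z = w at hne ⊢
    field_simp
    ring

theorem hasTemperateGrowth_resolventSymbol {z : ℂ} (hz : ∀ t : ℝ, 0 ≤ t → (t : ℂ) ≠ z) :
    (resolventSymbol z).HasTemperateGrowth := by
  obtain ⟨d, hd, hdle⟩ := exists_pos_le_norm_sub hz
  have hcd : ContDiffOn ℝ ⊤ (fun s : ℝ => ((s : ℂ) - z)⁻¹) (Set.Ici 0) := by
    refine ContDiffOn.inv ?_ fun t ht => sub_ne_zero.2 (hz t ht)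
    exact ((Complex.ofRealCLM.contDiff.sub contDiff_const)).contDiffOn
  refine Function.HasTemperateGrowth.comp' (g := fun s : ℝ => ((s : ℂ) - z)⁻¹)
    (f := bilaplaceSymbol) (t := Set.Ici 0) ?_ (uniqueDiffOn_Ici 0) (hcd.of_le le_top) ?_
    hasTemperateGrowth_bilaplaceSymbol
  · rintro _ ⟨ξ, rfl⟩
    exact bilaplaceSymbol_nonneg ξ
  · intro N
    refine ⟨0, ∑ n ∈ Finset.range (N + 1), n.factorial * (d⁻¹) ^ (n + 1), by positivity,
      fun n hn t ht => ?_⟩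
    rw [norm_iteratedFDerivWithin_eq_norm_iteratedDerivWithin, iteratedDerivWithin_inv_sub hz n t ht,
      pow_zero, mul_one]
    refine le_trans ?_ (Finset.single_le_sum
      (f := fun n : ℕ => (n.factorial : ℝ) * (d⁻¹) ^ (n + 1)) (fun n _ => by positivity)
      (Finset.mem_range.2 (Nat.lt_succ_of_le hn)))
    simp only [norm_mul, norm_pow, norm_neg, norm_one, one_pow, one_mul, norm_inv,
      Complex.norm_natCast]
    gcongr
    exact hdle t ht

theorem exists_norm_resolventSymbol_le {z : ℂ} (hz : ∀ t : ℝ, 0 ≤ t → (t : ℂ) ≠ z) :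
    ∃ C : ℝ, ∀ ξ, ‖resolventSymbol z ξ‖ * (1 + ‖ξ‖ ^ 2) ^ 2 ≤ C := by
  obtain ⟨d, hd, hdle⟩ := exists_pos_le_norm_sub hz
  refine ⟨2 * ((1 + ‖z‖) / d + 1), fun ξ => ?_⟩
  have ht := bilaplaceSymbol_nonneg ξ
  set t := bilaplaceSymbol ξ with htdef
  have h1 := hdle t ht
  have h2 : t ≤ ‖z‖ + ‖(t : ℂ) - z‖ := by
    have h := norm_add_le z ((t : ℂ) - z)
    rwa [add_sub_cancel, Complex.norm_real, Real.norm_of_nonneg ht] at h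
  have h3 : (‖ξ‖ ^ 2) ^ 2 ≤ t := by
    rw [htdef, bilaplaceSymbol]
    refine le_mul_of_one_le_left (by positivity) (one_le_pow₀ ?_)
    linarith [Real.pi_gt_three]
  have h4 : 1 + ‖z‖ ≤ (1 + ‖z‖) / d * ‖(t : ℂ) - z‖ := by
    rw [div_mul_eq_mul_div, le_div_iff₀ hd]
    gcongr
  rw [resolventSymbol, norm_inv, inv_mul_le_iff₀ (hd.trans_le h1)]
  nlinarith [sq_nonneg (1 - ‖ξ‖ ^ 2)]

theorem memLp_top_resolventSymbol {z : ℂ} (hz : ∀ t : ℝ, 0 ≤ t → (t : ℂ) ≠ z) :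
    MemLp (resolventSymbol z) ∞ (volume : Measure E3) := by
  obtain ⟨C, hC⟩ := exists_norm_resolventSymbol_le hz
  refine memLp_top_of_bound
    (hasTemperateGrowth_resolventSymbol hz).1.continuous.aestronglyMeasurable C
    (Filter.Eventually.of_forall fun ξ => le_trans ?_ (hC ξ))
  exact le_mul_of_one_le_right (norm_nonneg _) (one_le_pow₀ (by simp))

theorem integrable_resolventSymbol {z : ℂ} (hz : ∀ t : ℝ, 0 ≤ t → (t : ℂ) ≠ z) :
    Integrable (resolventSymbol z) (volume : Measure E3) := by
  obtain ⟨C, hC⟩ := exists_norm_resolventSymbol_le hz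
  have h : Integrable (fun x : E3 => (1 + ‖x‖ ^ 2) ^ (-(4 : ℝ) / 2)) :=
    integrable_rpow_neg_one_add_norm_sq (by rw [finrank_euclideanSpace_fin]; norm_num)
  refine (h.const_mul C).mono'
    (hasTemperateGrowth_resolventSymbol hz).1.continuous.aestronglyMeasurable
    (Filter.Eventually.of_forall fun ξ => ?_)
  have : (-(4 : ℝ) / 2) = -((2 : ℕ) : ℝ) := by norm_num
  rw [this, Real.rpow_neg (by positivity), Real.rpow_natCast, ← div_eq_mul_inv,
    le_div_iff₀ (by positivity)]
  exact hC ξ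

theorem coeFn_boundedMulOp {m : E3 → ℂ} (hm : MemLp m ∞ volume) (f : L2) :
    boundedMulOp m f =ᵐ[volume] fun x => m x * f x := by
  rw [boundedMulOp, dif_pos hm]
  filter_upwards [ContinuousLinearMap.coeFn_holder (r := 2) (ContinuousLinearMap.mul ℂ ℂ) (hm.toLp m) f,
    hm.coeFn_toLp] with x hx hx'
  refine hx.trans ?_
  rw [hx', ContinuousLinearMap.mul_apply']

/-- The free resolvent `(Δ² - z)⁻¹`, conjugated by the Fourier transform to a multiplication
operator. -/
def freeResolvent (z : ℂ) : L2 →L[ℂ] L2 :=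
  ((Lp.fourierTransformₗᵢ E3 ℂ).symm : L2 →L[ℂ] L2) ∘L boundedMulOp (resolventSymbol z) ∘L
    ((Lp.fourierTransformₗᵢ E3 ℂ : L2 ≃ₗᵢ[ℂ] L2) : L2 →L[ℂ] L2)

theorem coe_freeResolvent {z : ℂ} (hz : ∀ t : ℝ, 0 ≤ t → (t : ℂ) ≠ z) (f : L2) :
    ((freeResolvent z f : L2) : 𝓢'(E3, ℂ)) =
      fourierMultiplierCLM ℂ (resolventSymbol z) (f : 𝓢'(E3, ℂ)) := by
  have h1 : freeResolvent z f = 𝓕⁻ (boundedMulOp (resolventSymbol z) (𝓕 f)) := rfl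
  have hm := memLp_top_resolventSymbol hz
  have h2 : boundedMulOp (resolventSymbol z) (𝓕 f) = (hm.toLp _ • (𝓕 f : L2) : L2) := by
    refine Lp.ext ?_
    filter_upwards [coeFn_boundedMulOp hm (𝓕 f), Lp.coeFn_lpSMul (r := 2) (hm.toLp _) (𝓕 f : L2),
      hm.coeFn_toLp] with x hx hx' hx''
    rw [hx, hx', Pi.smul_apply', hx'', smul_eq_mul]
  rw [h1, h2, fourierMultiplierCLM_apply, Lp.fourier_toTemperedDistribution_eq,
    ← Lp.toTemperedDistribution_smul_eq (q := 2) (r := 2)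
      (hasTemperateGrowth_resolventSymbol hz) hm,
    Lp.fourierInv_toTemperedDistribution_eq]

theorem laplacian_laplacian_sub_smul (u : 𝓢'(E3, ℂ)) (z : ℂ) :
    Δ (Δ u) - z • u = fourierMultiplierCLM ℂ (fun ξ => (bilaplaceSymbol ξ : ℂ) - z) u := by
  have hg : (fun ξ : E3 => ((‖ξ‖ ^ 2 : ℝ) : ℂ)).HasTemperateGrowth := by fun_prop
  have hb : (fun ξ : E3 => (bilaplaceSymbol ξ : ℂ)).HasTemperateGrowth := by
    unfold bilaplaceSymbol; fun_prop
  have e1 : Δ (Δ u) = fourierMultiplierCLM ℂ (fun ξ => (bilaplaceSymbol ξ : ℂ)) u := by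
    rw [laplacian_eq_fourierMultiplierCLM, laplacian_eq_fourierMultiplierCLM,
      ContinuousLinearMap.map_smul_of_tower, fourierMultiplierCLM_fourierMultiplierCLM_apply hg hg,
      smul_smul, ← Complex.coe_smul]
    change ((_ : ℂ) • fourierMultiplierCLM ℂ _) u = _
    rw [← fourierMultiplierCLM_smul (hg.mul hg)]
    congr 2
    ext ξ
    simp only [Pi.smul_apply, Pi.mul_apply, smul_eq_mul, bilaplaceSymbol]
    push_cast; ring
  rw [e1, fourierMultiplierCLM_apply, fourierMultiplierCLM_apply]
  have e2 : (fun ξ : E3 => (bilaplaceSymbol ξ : ℂ) - z) =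
      (fun ξ => (bilaplaceSymbol ξ : ℂ)) - fun _ => z := rfl
  rw [e2, smulLeftCLM_sub hb (Function.HasTemperateGrowth.const z),
    sub_apply, smulLeftCLM_const, sub_eq_add_neg (smulLeftCLM _ _ _), fourierInv_add, sub_eq_add_neg,
    ← neg_smul, fourierInv_smul, fourierInv_fourier_eq, neg_smul]

theorem freeResolvent_mem_sobolevH4 {z : ℂ} (hz : ∀ t : ℝ, 0 ≤ t → (t : ℂ) ≠ z) (f : L2) :
    freeResolvent z f ∈ sobolevH4 := by
  change MemSobolev 4 2 _
  rw [coe_freeResolvent hz]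
  have hg := hasTemperateGrowth_resolventSymbol hz
  have hb : (fun ξ : E3 => (((1 + ‖ξ‖ ^ 2) ^ ((4 : ℝ) / 2) : ℝ) : ℂ)).HasTemperateGrowth := by
    fun_prop
  have h0 : MemSobolev 0 2 (f : 𝓢'(E3, ℂ)) := memSobolev_zero_iff.2 ⟨f, rfl⟩
  obtain ⟨C, hC⟩ := exists_norm_resolventSymbol_le hz
  have h1 := h0.fourierMultiplierCLM_of_bounded (hg.mul hb) ⟨C, fun ξ => by
    refine le_trans (le_of_eq ?_) (hC ξ)
    have : ((4 : ℝ) / 2) = ((2 : ℕ) : ℝ) := by norm_num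
    rw [Pi.mul_apply, norm_mul, Complex.norm_real, Real.norm_of_nonneg (by positivity), this,
      Real.rpow_natCast]⟩
  obtain ⟨f', hf'⟩ := memSobolev_zero_iff.1 h1
  refine ⟨f', ?_⟩
  rw [besselPotential, fourierMultiplierCLM_fourierMultiplierCLM_apply hg hb, ← hf']

theorem isResolvent_freeResolvent {z : ℂ} (hz : ∀ t : ℝ, 0 ≤ t → (t : ℂ) ≠ z) :
    IsResolvent freeHamiltonian z (freeResolvent z) := by
  have hg := hasTemperateGrowth_resolventSymbol hz
  have hb : (fun ξ : E3 => (bilaplaceSymbol ξ : ℂ) - z).HasTemperateGrowth := by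
    unfold bilaplaceSymbol; fun_prop
  have hmul : resolventSymbol z * (fun ξ : E3 => (bilaplaceSymbol ξ : ℂ) - z) = fun _ => 1 := by
    ext ξ
    exact inv_mul_cancel₀ (sub_ne_zero.2 (hz _ (bilaplaceSymbol_nonneg ξ)))
  have hsub : ∀ u : sobolevH4, ((bilaplacian u - z • (u : L2) : L2) : 𝓢'(E3, ℂ)) =
      fourierMultiplierCLM ℂ (fun ξ => (bilaplaceSymbol ξ : ℂ) - z) ((u : L2) : 𝓢'(E3, ℂ)) := by
    intro u
    rw [← laplacian_laplacian_sub_smul, ← bilaplacian_spec, sub_eq_add_neg, ← neg_smul,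
      toTemperedDistribution_add, toTemperedDistribution_smul, neg_smul, ← sub_eq_add_neg]
  refine ⟨fun f => ⟨freeResolvent_mem_sobolevH4 hz f, ?_⟩, fun u => ?_⟩
  · apply toTemperedDistribution_inj
    refine (hsub ⟨freeResolvent z f, freeResolvent_mem_sobolevH4 hz f⟩).trans ?_
    rw [coe_freeResolvent hz, fourierMultiplierCLM_fourierMultiplierCLM_apply hg hb, hmul,
      fourierMultiplierCLM_const]
    simp
  · apply toTemperedDistribution_inj
    rw [coe_freeResolvent hz]
    refine (congrArg _ (hsub u)).trans ?_
    rw [fourierMultiplierCLM_fourierMultiplierCLM_apply hb hg, mul_comm, hmul,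
      fourierMultiplierCLM_const]
    simp

/-! ### The integral kernel of the free resolvent -/

/-- The convolution kernel `(e^{iμ|x|} - e^{-μ|x|}) / (8πμ²|x|)` of `(Δ² - μ⁴)⁻¹`. Its value at the
origin is `0` by the convention for division by zero, not the continuous extension. -/
def greenKernel (μ : ℂ) (x : E3) : ℂ :=
  (Complex.exp (Complex.I * μ * ‖x‖) - Complex.exp (-μ * ‖x‖)) / (8 * Real.pi * μ ^ 2 * ‖x‖)

variable {μ : ℂ}

/-- The fourth power of a point of the open first quadrant avoids the spectrum `[0, ∞)` of `Δ²`: a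
real fourth power forces `Re μ = Im μ`, and then it is negative. -/
theorem ofReal_ne_pow_four (hre : 0 < μ.re) (him : 0 < μ.im) (t : ℝ) (ht : 0 ≤ t) :
    (t : ℂ) ≠ μ ^ 4 := by
  intro h
  have h1 := congrArg Complex.re h
  have h2 := congrArg Complex.im h
  simp only [pow_succ, pow_zero, one_mul, Complex.mul_re, Complex.mul_im, Complex.ofReal_re,
    Complex.ofReal_im] at h1 h2
  have h3 : (μ.re * μ.im) * (μ.re ^ 2 - μ.im ^ 2) = 0 := by linarith
  have h4 : μ.re ^ 2 = μ.im ^ 2 := by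
    have := (mul_eq_zero.1 h3).resolve_left (mul_pos hre him).ne'
    linarith
  have h5 : t = μ.re ^ 2 * μ.re ^ 2 + μ.im ^ 2 * μ.im ^ 2 - 6 * (μ.re ^ 2 * μ.im ^ 2) := by
    linarith
  rw [h4] at h5
  nlinarith [pow_pos him 4]

theorem re_neg_I_mul_pos (him : 0 < μ.im) : 0 < (-(Complex.I * μ)).re := by simpa using him

theorem greenKernel_eq_yukawa (μ : ℂ) : greenKernel μ =
    fun x => (8 * Real.pi * μ ^ 2 : ℂ)⁻¹ * (yukawa (-(Complex.I * μ)) x - yukawa μ x) := by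
  ext x
  rw [greenKernel, yukawa, yukawa, neg_neg, ← sub_div, ← div_eq_inv_mul, div_div, mul_comm (‖x‖ : ℂ)]

theorem integrable_greenKernel (hre : 0 < μ.re) (him : 0 < μ.im) :
    Integrable (greenKernel μ) := by
  rw [greenKernel_eq_yukawa]
  exact ((integrable_yukawa (re_neg_I_mul_pos him)).sub (integrable_yukawa hre)).const_mul _

/-- Partial fractions: `1/(k² - μ⁴) = (1/(k - μ²) - 1/(k + μ²)) / (2μ²)` with `k = (2π|ξ|)²`. -/
theorem fourier_greenKernel (hre : 0 < μ.re) (him : 0 < μ.im) :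
    𝓕 (greenKernel μ) = resolventSymbol (μ ^ 4) := by
  have hμ : μ ≠ 0 := fun h => by simp [h] at hre
  have i1 := integrable_yukawa (re_neg_I_mul_pos him)
  have i2 := integrable_yukawa hre
  ext ξ
  have h1 : 𝓕 (greenKernel μ) ξ = (8 * Real.pi * μ ^ 2 : ℂ)⁻¹ *
      (𝓕 (yukawa (-(Complex.I * μ))) ξ - 𝓕 (yukawa μ) ξ) := by
    rw [greenKernel_eq_yukawa, Real.fourier_eq, Real.fourier_eq, Real.fourier_eq,
      ← integral_sub ((Real.fourierIntegral_convergent_iff ξ).2 i1)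
        ((Real.fourierIntegral_convergent_iff ξ).2 i2), ← integral_const_mul]
    refine integral_congr_ae (Filter.Eventually.of_forall fun x => ?_)
    simp only [Circle.smul_def, smul_eq_mul]
    ring
  rw [h1, fourier_yukawa (re_neg_I_mul_pos him), fourier_yukawa hre, resolventSymbol]
  set k : ℂ := ((2 * Real.pi * ‖ξ‖ : ℝ) : ℂ) ^ 2 with hk
  have hkr : k = (((2 * Real.pi * ‖ξ‖) ^ 2 : ℝ) : ℂ) := by rw [hk]; push_cast; ring
  have hsym : ((bilaplaceSymbol ξ : ℝ) : ℂ) = k ^ 2 := by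
    rw [hk, bilaplaceSymbol]; push_cast; ring
  have hI : (-(Complex.I * μ)) ^ 2 = -μ ^ 2 := by rw [neg_sq, mul_pow, Complex.I_sq]; ring
  have hne : k ^ 2 - μ ^ 4 ≠ 0 := by
    rw [← hsym]
    exact sub_ne_zero.2 (ofReal_ne_pow_four hre him _ (bilaplaceSymbol_nonneg ξ))
  have hfac : k ^ 2 - μ ^ 4 = (-μ ^ 2 + k) * (μ ^ 2 + k) := by ring
  rw [hfac] at hne
  have n1 := left_ne_zero_of_mul hne
  have n2 := right_ne_zero_of_mul hne
  have hpi : (Real.pi : ℂ) ≠ 0 := Complex.ofReal_ne_zero.2 Real.pi_ne_zero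
  rw [hsym, hfac, hI]
  field_simp
  ring

theorem fourierInv_resolventSymbol (hre : 0 < μ.re) (him : 0 < μ.im) {x : E3} (hx : x ≠ 0) :
    𝓕⁻ (resolventSymbol (μ ^ 4)) x = greenKernel μ x := by
  have hμ : μ ≠ 0 := fun h => by simp [h] at hre
  have hint := integrable_resolventSymbol (ofReal_ne_pow_four hre him)
  rw [← fourier_greenKernel hre him] at hint ⊢
  refine (integrable_greenKernel hre him).fourierInv_fourier_eq hint ?_
  have hpi : (Real.pi : ℂ) ≠ 0 := Complex.ofReal_ne_zero.2 Real.pi_ne_zero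
  have hd : (8 * Real.pi * μ ^ 2 * ‖x‖ : ℂ) ≠ 0 := by
    have : (‖x‖ : ℂ) ≠ 0 := Complex.ofReal_ne_zero.2 (norm_ne_zero_iff.2 hx)
    simp [hμ, hpi, hx]
  unfold greenKernel
  fun_prop (disch := assumption)

/-! ### Taylor remainders of the exponential on the left half-plane -/

/-- The Taylor remainder of order `N` of the exponential function. -/
def expRem (N : ℕ) (z : ℂ) : ℂ := Complex.exp z - ∑ n ∈ Finset.range N, z ^ n / n.factorial

theorem hasDerivAt_expRem_succ (N : ℕ) (z : ℂ) : HasDerivAt (expRem (N + 1)) (expRem N z) z := by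
  refine (Complex.hasDerivAt_exp z).sub ?_
  have h : ∀ n ∈ Finset.range (N + 1), HasDerivAt (fun w : ℂ => w ^ n / n.factorial)
      ((n * z ^ (n - 1)) / n.factorial) z := fun n _ => (hasDerivAt_pow n z).div_const _
  have hs := HasDerivAt.fun_sum h
  convert! hs using 1
  rw [Finset.sum_range_succ']
  simp only [Nat.cast_zero, zero_mul, zero_div, add_zero, Nat.add_sub_cancel]
  refine Finset.sum_congr rfl fun n _ => ?_
  rw [Nat.factorial_succ]
  have : ((n : ℂ) + 1) ≠ 0 := by exact_mod_cast Nat.succ_ne_zero n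
  have : (n.factorial : ℂ) ≠ 0 := by exact_mod_cast n.factorial_ne_zero
  push_cast
  field_simp

/-- On the left half-plane the exponential is bounded by one, so that its Taylor remainders are
bounded by powers of `|z|` without an exponential factor. -/
theorem norm_expRem_le (N : ℕ) {z : ℂ} (hz : z.re ≤ 0) : ‖expRem N z‖ ≤ ‖z‖ ^ N := by
  induction N generalizing z with
  | zero => simpa [expRem, Complex.norm_exp] using hz
  | succ N ih =>
    have hsub : ∀ w ∈ segment ℝ 0 z, w.re ≤ 0 ∧ ‖w‖ ≤ ‖z‖ := by
      rintro w ⟨s, t, hs, ht, hst, rfl⟩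
      simp only [smul_zero, zero_add, Complex.real_smul, norm_mul, Complex.norm_real,
        Complex.re_ofReal_mul, Real.norm_of_nonneg ht]
      exact ⟨mul_nonpos_of_nonneg_of_nonpos ht hz,
        mul_le_of_le_one_left (norm_nonneg _) (by linarith)⟩
    have h := Convex.norm_image_sub_le_of_norm_hasDerivWithin_le (f := expRem (N + 1))
      (f' := expRem N) (s := segment ℝ 0 z) (C := ‖z‖ ^ N)
      (fun w _ => (hasDerivAt_expRem_succ N w).hasDerivWithinAt)
      (fun w hw => (ih (hsub w hw).1).trans (by gcongr; exact (hsub w hw).2))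
      (convex_segment 0 z) (left_mem_segment ℝ 0 z) (right_mem_segment ℝ 0 z)
    have h0 : expRem (N + 1) 0 = 0 := by
      simp [expRem, Finset.sum_range_succ']
    rwa [h0, sub_zero, sub_zero, ← pow_succ] at h

/-- Geometric mean of the bounds of orders `N` and `N + 1`; it allows for half-integer orders. -/
theorem norm_expRem_sq_le (N : ℕ) {z : ℂ} (hz : z.re ≤ 0) :
    ‖expRem (N + 1) z‖ ^ 2 ≤ 2 * ‖z‖ ^ (2 * N + 1) := by
  have h1 := norm_expRem_le (N + 1) hz
  have h2 : ‖expRem (N + 1) z‖ ≤ 2 * ‖z‖ ^ N := by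
    have e : expRem (N + 1) z = expRem N z - z ^ N / N.factorial := by
      rw [expRem, expRem, Finset.sum_range_succ]; ring
    rw [e]
    refine (norm_sub_le _ _).trans ?_
    have h3 : ‖z ^ N / N.factorial‖ ≤ ‖z‖ ^ N := by
      rw [norm_div, norm_pow, Complex.norm_natCast]
      exact div_le_self (by positivity) (by exact_mod_cast N.factorial_pos)
    linarith [norm_expRem_le N hz]
  calc ‖expRem (N + 1) z‖ ^ 2 = ‖expRem (N + 1) z‖ * ‖expRem (N + 1) z‖ := sq _
    _ ≤ (2 * ‖z‖ ^ N) * ‖z‖ ^ (N + 1) := mul_le_mul h2 h1 (norm_nonneg _) (by positivity)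
    _ = _ := by ring

theorem re_I_mul_nonpos (him : 0 < μ.im) (r : ℝ) (hr : 0 ≤ r) :
    (Complex.I * μ * r).re ≤ 0 := by
  simp only [Complex.re_mul_ofReal, Complex.I_mul_re]
  nlinarith

theorem re_neg_mul_nonpos (hre : 0 < μ.re) (r : ℝ) (hr : 0 ≤ r) : (-μ * r).re ≤ 0 := by
  simp only [Complex.re_mul_ofReal, Complex.neg_re]
  nlinarith

/-! ### The free resolvent as an integral operator -/

theorem norm_greenKernel_le (hre : 0 < μ.re) (him : 0 < μ.im) (x : E3) :
    ‖greenKernel μ x‖ ≤ ‖μ‖⁻¹ := by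
  have hμ : μ ≠ 0 := fun h => by simp [h] at hre
  have hμ' : 0 < ‖μ‖ := norm_pos_iff.2 hμ
  rcases eq_or_ne x 0 with rfl | hx
  · simp [greenKernel]
  have hr : 0 < ‖x‖ := norm_pos_iff.2 hx
  have h1 := norm_expRem_le 1 (re_I_mul_nonpos him ‖x‖ hr.le)
  have h2 := norm_expRem_le 1 (re_neg_mul_nonpos hre ‖x‖ hr.le)
  have e : Complex.exp (Complex.I * μ * ‖x‖) - Complex.exp (-μ * ‖x‖) =
      expRem 1 (Complex.I * μ * ‖x‖) - expRem 1 (-μ * ‖x‖) := by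
    simp [expRem]
  simp only [norm_mul, norm_neg, Complex.norm_I, one_mul, pow_one, Complex.norm_real, norm_norm]
    at h1 h2
  have hden : ‖(8 * Real.pi * μ ^ 2 * ‖x‖ : ℂ)‖ = 8 * Real.pi * ‖μ‖ ^ 2 * ‖x‖ := by
    simp [abs_of_pos Real.pi_pos]
  rw [greenKernel, norm_div, hden, e, div_le_iff₀ (by positivity)]
  have h3 : ‖μ‖⁻¹ * (8 * Real.pi * ‖μ‖ ^ 2 * ‖x‖) = 8 * Real.pi * (‖μ‖ * ‖x‖) := by field_simp
  rw [h3]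
  refine (norm_sub_le _ _).trans ((add_le_add h1 h2).trans ?_)
  nlinarith [Real.pi_gt_three, mul_pos hμ' hr]

theorem measurable_greenKernel (μ : ℂ) : Measurable (greenKernel μ) := by
  unfold greenKernel; fun_prop

theorem memLp_two_greenKernel (hre : 0 < μ.re) (him : 0 < μ.im) :
    MemLp (greenKernel μ) 2 volume := by
  refine (memLp_two_iff_integrable_sq_norm (measurable_greenKernel μ).aestronglyMeasurable).2 ?_
  refine ((integrable_greenKernel hre him).norm.const_mul ‖μ‖⁻¹).mono'
    ((measurable_greenKernel μ).norm.pow_const 2).aestronglyMeasurable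
    (Filter.Eventually.of_forall fun x => ?_)
  rw [Real.norm_of_nonneg (by positivity), sq]
  exact mul_le_mul_of_nonneg_right (norm_greenKernel_le hre him x) (norm_nonneg _)

theorem memLp_two_greenKernel_sub (hre : 0 < μ.re) (him : 0 < μ.im) (x : E3) :
    MemLp (fun y => greenKernel μ (x - y)) 2 volume :=
  (memLp_two_greenKernel hre him).comp_measurePreserving
    (Measure.measurePreserving_sub_left volume x)

/-- The convolution of the Green kernel with a function. -/
def greenConv (μ : ℂ) (f : E3 → ℂ) (x : E3) : ℂ := ∫ y, greenKernel μ (x - y) * f y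

/-- Evaluation of the convolution at a point is a bounded functional on `L²`, uniformly in the
point. -/
theorem exists_greenConv_eq_inner (hre : 0 < μ.re) (him : 0 < μ.im) (x : E3) :
    ∃ g : L2, ‖g‖ = (eLpNorm (greenKernel μ) 2 volume).toReal ∧
      ∀ f : L2, greenConv μ f x = inner ℂ g f := by
  have hm := (memLp_two_greenKernel_sub hre him x).star
  refine ⟨hm.toLp, ?_, fun f => ?_⟩
  · rw [Lp.norm_toLp]
    congr 1
    rw [← eLpNorm_comp_measurePreserving (measurable_greenKernel μ).aestronglyMeasurable
      (Measure.measurePreserving_sub_left volume x)]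
    refine eLpNorm_congr_norm_ae (Filter.Eventually.of_forall fun y => ?_)
    simp
  · rw [L2.inner_def]
    refine integral_congr_ae ?_
    filter_upwards [hm.coeFn_toLp] with y hy
    rw [hy]
    simp [mul_comm]

theorem norm_greenConv_le (hre : 0 < μ.re) (him : 0 < μ.im) (f : L2) (x : E3) :
    ‖greenConv μ f x‖ ≤ (eLpNorm (greenKernel μ) 2 volume).toReal * ‖f‖ := by
  obtain ⟨g, hg, hgf⟩ := exists_greenConv_eq_inner hre him x
  rw [hgf, ← hg]
  exact norm_inner_le_norm g f

/-- For Schwartz functions the Fourier multiplier is given by an absolutely convergent integral, and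
Fubini's theorem moves the inverse Fourier transform onto the symbol. -/
theorem greenConv_schwartz (hre : 0 < μ.re) (him : 0 < μ.im) (f : 𝓢(E3, ℂ)) (x : E3) :
    SchwartzMap.fourierMultiplierCLM ℂ (resolventSymbol (μ ^ 4)) f x = greenConv μ f x := by
  have hz := ofReal_ne_pow_four hre him
  rw [SchwartzMap.fourierMultiplierCLM_apply, SchwartzMap.fourierInv_coe, Real.fourierInv_eq]
  set h : E3 → ℂ := fun ξ => Real.fourierChar (inner ℝ ξ x) • resolventSymbol (μ ^ 4) ξ with hh
  have hint : Integrable h := by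
    have := (Real.fourierIntegral_convergent_iff (-x)).2 (integrable_resolventSymbol hz)
    simpa [hh, inner_neg_right] using this
  have e1 : ∀ ξ : E3, Real.fourierChar (inner ℝ ξ x) •
      SchwartzMap.smulLeftCLM ℂ (resolventSymbol (μ ^ 4)) (𝓕 f) ξ = 𝓕 (f : E3 → ℂ) ξ • h ξ := by
    intro ξ
    rw [SchwartzMap.smulLeftCLM_apply_apply (hasTemperateGrowth_resolventSymbol hz),
      SchwartzMap.fourier_coe, hh]
    simp only [Circle.smul_def, smul_eq_mul]
    ring
  simp_rw [e1]
  refine (VectorFourier.integral_fourierIntegral_smul_eq_flip (L := innerₗ E3)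
    Real.continuous_fourierChar continuous_inner f.integrable hint).trans ?_
  rw [greenConv]
  refine integral_congr_ae ?_
  filter_upwards [Measure.ae_ne volume x] with y hy
  rw [← fourierInv_resolventSymbol hre him (sub_ne_zero.2 hy.symm), smul_eq_mul, mul_comm,
    flip_innerₗ]
  congr 1
  refine (Real.fourier_eq h y).trans ?_
  rw [Real.fourierInv_eq]
  refine integral_congr_ae (Filter.Eventually.of_forall fun ξ => ?_)
  simp only [hh, smul_smul]
  rw [← AddChar.map_add_eq_mul, inner_sub_right]
  congr 2
  ring

/-- The free resolvent is convolution with the Green kernel. -/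
theorem coeFn_freeResolvent (hre : 0 < μ.re) (him : 0 < μ.im) (f : L2) :
    freeResolvent (μ ^ 4) f =ᵐ[volume] greenConv μ f := by
  have hz := ofReal_ne_pow_four hre him
  -- For Schwartz functions this is the Fourier inversion formula.
  have hS : ∀ φ : 𝓢(E3, ℂ), freeResolvent (μ ^ 4) (φ.toLp 2) =ᵐ[volume]
      greenConv μ (φ.toLp 2 : L2) := by
    intro φ
    have h1 : freeResolvent (μ ^ 4) (φ.toLp 2) =
        (SchwartzMap.fourierMultiplierCLM ℂ (resolventSymbol (μ ^ 4)) φ).toLp 2 := by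
      apply toTemperedDistribution_inj
      rw [coe_freeResolvent hz, Lp.toTemperedDistribution_toLp_eq,
        Lp.toTemperedDistribution_toLp_eq, fourierMultiplierCLM_toTemperedDistributionCLM_eq
          (hasTemperateGrowth_resolventSymbol hz)]
    rw [h1]
    filter_upwards [SchwartzMap.coeFn_toLp
      (SchwartzMap.fourierMultiplierCLM ℂ (resolventSymbol (μ ^ 4)) φ) 2 volume] with x hx
    rw [hx, greenConv_schwartz hre him, greenConv, greenConv]
    refine integral_congr_ae ?_
    filter_upwards [SchwartzMap.coeFn_toLp φ 2 volume] with y hy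
    rw [hy]
  -- Both sides depend continuously on `f`, in `L²` and pointwise respectively.
  have hd : DenseRange (SchwartzMap.toLpCLM ℝ ℂ (E := E3) 2 volume) :=
    SchwartzMap.denseRange_toLpCLM ENNReal.ofNat_ne_top
  obtain ⟨u, hu, hlim⟩ := mem_closure_iff_seq_limit.1 (hd f)
  choose φ hφ using hu
  have hlim2 : Filter.Tendsto (fun n => freeResolvent (μ ^ 4) (u n)) Filter.atTop
      (nhds (freeResolvent (μ ^ 4) f)) := ((freeResolvent (μ ^ 4)).continuous.tendsto f).comp hlim
  obtain ⟨ns, hns, hae⟩ := (tendstoInMeasure_of_tendsto_Lp hlim2).exists_seq_tendsto_ae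
  have hall : ∀ᵐ x : E3, ∀ n, freeResolvent (μ ^ 4) (u n) x = greenConv μ (u n) x := by
    refine ae_all_iff.2 fun n => ?_
    have := hS (φ n)
    rw [← hφ n]
    exact this
  filter_upwards [hae, hall] with x hx hx'
  obtain ⟨g, -, hgf⟩ := exists_greenConv_eq_inner hre him x
  refine tendsto_nhds_unique hx ?_
  simp_rw [hx', hgf]
  exact ((innerSL ℂ g).continuous.tendsto f).comp (hlim.comp hns.tendsto_atTop)

/-! ### Hilbert–Schmidt operators and multiplication operators -/

section Kernels

variable {k k₁ k₂ : E3 × E3 → ℂ}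

theorem coeFn_kernelOp (hk : MemLp k 2 ((volume : Measure E3).prod volume)) (f : L2) :
    kernelOp k f =ᵐ[volume] fun x => ∫ y, k (x, y) * f y := by
  rw [kernelOp, dif_pos hk]
  exact (memLp_integral_kernel hk f).1.coeFn_toLp

theorem norm_kernelOp_le (hk : MemLp k 2 ((volume : Measure E3).prod volume)) :
    ‖kernelOp k‖ ≤ (eLpNorm k 2 ((volume : Measure E3).prod volume)).toReal := by
  rw [kernelOp, dif_pos hk]
  exact LinearMap.mkContinuous_norm_le _ ENNReal.toReal_nonneg _

theorem kernelOp_add (h₁ : MemLp k₁ 2 ((volume : Measure E3).prod volume))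
    (h₂ : MemLp k₂ 2 ((volume : Measure E3).prod volume)) :
    kernelOp (k₁ + k₂) = kernelOp k₁ + kernelOp k₂ := by
  ext1 f
  refine Lp.ext ?_
  rw [add_apply]
  filter_upwards [coeFn_kernelOp (h₁.add h₂) f, coeFn_kernelOp h₁ f, coeFn_kernelOp h₂ f,
    Lp.coeFn_add (kernelOp k₁ f) (kernelOp k₂ f), ae_integrable_kernel h₁ f,
    ae_integrable_kernel h₂ f] with x h e₁ e₂ ha i₁ i₂
  rw [h, ha, Pi.add_apply, e₁, e₂, ← integral_add i₁ i₂]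
  simp only [Pi.add_apply, add_mul]

theorem kernelOp_const_smul (c : ℂ) (hk : MemLp k 2 ((volume : Measure E3).prod volume)) :
    kernelOp (c • k) = c • kernelOp k := by
  ext1 f
  refine Lp.ext ?_
  rw [smul_apply]
  filter_upwards [coeFn_kernelOp (hk.const_smul c) f, coeFn_kernelOp hk f,
    Lp.coeFn_smul c (kernelOp k f)] with x h e₁ ha
  rw [h, ha, Pi.smul_apply, e₁, smul_eq_mul, ← integral_const_mul]
  simp only [Pi.smul_apply, smul_eq_mul, mul_assoc]

theorem kernelOp_zero : kernelOp (0 : E3 × E3 → ℂ) = 0 := by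
  have h := kernelOp_const_smul 0
    (MemLp.zero' (ε := ℂ) (p := 2) (μ := (volume : Measure E3).prod volume))
  simpa using h

theorem kernelOp_sum {ι : Type*} (s : Finset ι) {k : ι → E3 × E3 → ℂ}
    (hk : ∀ i ∈ s, MemLp (k i) 2 ((volume : Measure E3).prod volume)) :
    kernelOp (∑ i ∈ s, k i) = ∑ i ∈ s, kernelOp (k i) := by
  classical
  induction s using Finset.induction_on with
  | empty => simpa using kernelOp_zero
  | insert i s hi ih =>
    have hs : ∀ j ∈ s, MemLp (k j) 2 ((volume : Measure E3).prod volume) :=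
      fun j hj => hk j (Finset.mem_insert_of_mem hj)
    rw [Finset.sum_insert hi, Finset.sum_insert hi,
      kernelOp_add (hk i (Finset.mem_insert_self i s)) (memLp_finsetSum' s hs), ih hs]

theorem ae_fst_ne_snd : ∀ᵐ z ∂((volume : Measure E3).prod volume), z.1 ≠ z.2 := by
  have hm : MeasurableSet {z : E3 × E3 | z.1 ≠ z.2} :=
    (measurableSet_eq_fun measurable_fst measurable_snd).compl
  refine (Measure.ae_prod_iff_ae_ae hm).2 (Filter.Eventually.of_forall fun x => ?_)
  filter_upwards [Measure.ae_ne volume x] with y hy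
  exact hy.symm

end Kernels

/-- The domain of a maximal multiplication operator is dense: a function orthogonal to it is
orthogonal to its own truncations to the sets where the multiplier is bounded. -/
theorem dense_mulDomain {m : E3 → ℂ} (hm : AEStronglyMeasurable m volume) :
    Dense (mulDomain m : Set L2) := by
  refine Submodule.dense_iff_topologicalClosure_eq_top.2 ?_
  rw [Submodule.topologicalClosure_eq_top_iff, Submodule.eq_bot_iff]
  intro g hg
  set m' := hm.mk m with hm'
  have hm'm : StronglyMeasurable m' := hm.stronglyMeasurable_mk
  have hS : ∀ n : ℕ, MeasurableSet {x | ‖m' x‖ ≤ n} := fun n =>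
    measurableSet_le hm'm.norm.measurable measurable_const
  have key : ∀ n : ℕ, ∀ᵐ x : E3, ‖m' x‖ ≤ n → g x = 0 := by
    intro n
    have hf : MemLp ({x | ‖m' x‖ ≤ n}.indicator g) 2 volume := (Lp.memLp g).indicator (hS n)
    have hmem : hf.toLp ∈ mulDomain m := by
      refine MemLp.of_le_mul (c := n) (Lp.memLp g) (hm.mul (Lp.aestronglyMeasurable _)) ?_
      filter_upwards [hf.coeFn_toLp, hm.ae_eq_mk] with x hx hx'
      rw [hx, norm_mul, hx']
      by_cases h : ‖m' x‖ ≤ n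
      · rw [Set.indicator_of_mem (by exact h)]
        exact mul_le_mul_of_nonneg_right h (norm_nonneg _)
      · rw [Set.indicator_of_notMem (by exact h), norm_zero, mul_zero]
        positivity
    have h0 := (Submodule.mem_orthogonal _ _).1 hg _ hmem
    have hself : inner ℂ hf.toLp hf.toLp = (0 : ℂ) := by
      rw [← h0, L2.inner_def, L2.inner_def]
      refine integral_congr_ae ?_
      filter_upwards [hf.coeFn_toLp] with x hx
      rw [hx]
      by_cases h : x ∈ {x | ‖m' x‖ ≤ n}
      · rw [Set.indicator_of_mem h]
      · rw [Set.indicator_of_notMem h, inner_zero_left, inner_zero_left]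
    have hzero := inner_self_eq_zero.1 hself
    filter_upwards [hf.coeFn_toLp, (Lp.eq_zero_iff_ae_eq_zero).1 hzero] with x hx hx0 hn
    rw [hx, Set.indicator_of_mem (by exact hn)] at hx0
    simpa using hx0
  refine (Lp.eq_zero_iff_ae_eq_zero).2 ?_
  filter_upwards [ae_all_iff.2 key] with x hx
  obtain ⟨n, hn⟩ := exists_nat_ge ‖m' x‖
  simpa using hx n hn

/-! ### The factorization of the potential -/

section Potential

variable {V : E3 → ℝ}

theorem vFun_mul_self (x : E3) : vFun V x * vFun V x = |V x| :=
  Real.mul_self_sqrt (abs_nonneg _)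

theorem uFun_mul_self (x : E3) : uFun V x * uFun V x = 1 := by
  unfold uFun; split_ifs <;> norm_num

theorem uFun_mul_abs (x : E3) : uFun V x * |V x| = V x := by
  unfold uFun
  split_ifs with h
  · rw [one_mul, abs_of_nonneg h]
  · rw [abs_of_neg (not_le.1 h)]; ring

theorem aestronglyMeasurable_vFun (hV : AEStronglyMeasurable V volume) :
    AEStronglyMeasurable (fun x => (vFun V x : ℂ)) volume := by
  have h : Measurable fun t : ℝ => ((√|t| : ℝ) : ℂ) := by fun_prop
  exact (h.comp_aemeasurable hV.aemeasurable).aestronglyMeasurable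

theorem aestronglyMeasurable_uFun (hV : AEStronglyMeasurable V volume) :
    AEStronglyMeasurable (fun x => (uFun V x : ℂ)) volume := by
  have h : Measurable fun t : ℝ => (((if 0 ≤ t then 1 else -1 : ℝ)) : ℂ) :=
    Complex.measurable_ofReal.comp
      (Measurable.ite measurableSet_Ici measurable_const measurable_const)
  refine (h.comp_aemeasurable hV.aemeasurable).aestronglyMeasurable.congr
    (Filter.Eventually.of_forall fun x => ?_)
  simp only [Function.comp_apply, uFun]

theorem memLp_uFun (hV : AEStronglyMeasurable V volume) :
    MemLp (fun x => (uFun V x : ℂ)) ∞ volume := by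
  refine memLp_top_of_bound (aestronglyMeasurable_uFun hV) 1
    (Filter.Eventually.of_forall fun x => ?_)
  rw [Complex.norm_real, uFun]
  split_ifs <;> simp

theorem coeFn_U (hV : AEStronglyMeasurable V volume) (f : L2) :
    U V f =ᵐ[volume] fun x => uFun V x * f x := coeFn_boundedMulOp (memLp_uFun hV) f

theorem U_U (hV : AEStronglyMeasurable V volume) (f : L2) : U V (U V f) = f := by
  refine Lp.ext ?_
  filter_upwards [coeFn_U hV (U V f), coeFn_U hV f] with x h1 h2
  rw [h1, h2, ← mul_assoc, ← Complex.ofReal_mul, uFun_mul_self, Complex.ofReal_one, one_mul]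

theorem memLp_vFun (hV : Integrable V volume) : MemLp (fun x => (vFun V x : ℂ)) 2 volume := by
  refine (memLp_two_iff_integrable_sq_norm (aestronglyMeasurable_vFun hV.1)).2 ?_
  refine hV.norm.congr (Filter.Eventually.of_forall fun x => ?_)
  simp only [Complex.norm_real]
  rw [Real.norm_eq_abs, Real.norm_eq_abs, sq_abs, sq, vFun_mul_self]

theorem coeFn_vVec (hV : Integrable V volume) : vVec V =ᵐ[volume] fun x => (vFun V x : ℂ) := by
  rw [vVec, dif_pos (memLp_vFun hV)]
  exact (memLp_vFun hV).coeFn_toLp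

/-! ### The kernels `v(x) φ(|x - y|) v(y)` -/

/-- The kernel `v(x) φ(|x - y|) v(y)`. -/
def sandwich (V : E3 → ℝ) (φ : ℝ → ℂ) (z : E3 × E3) : ℂ :=
  vFun V z.1 * φ ‖z.1 - z.2‖ * vFun V z.2

/-- The weight `v(x) (1 + |x|)^{n/2}`. -/
def vWeight (V : E3 → ℝ) (n : ℕ) (x : E3) : ℝ := √(|V x| * (1 + ‖x‖) ^ n)

theorem memLp_vWeight_prod {n : ℕ} (hF : Integrable (fun x => |V x| * (1 + ‖x‖) ^ n) volume) :
    MemLp (fun z : E3 × E3 => vWeight V n z.1 * vWeight V n z.2) 2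
      ((volume : Measure E3).prod volume) := by
  have hW : AEStronglyMeasurable (vWeight V n) volume :=
    (Real.continuous_sqrt.comp_aestronglyMeasurable hF.1)
  refine (memLp_two_iff_integrable_sq (hW.comp_fst.mul hW.comp_snd)).2 ?_
  refine (hF.mul_prod hF).congr (Filter.Eventually.of_forall fun z => ?_)
  change _ = (vWeight V n z.1 * vWeight V n z.2) ^ 2
  rw [mul_pow, vWeight, vWeight, Real.sq_sqrt (by positivity), Real.sq_sqrt (by positivity)]

theorem norm_sandwich_le {φ : ℝ → ℂ} {b : ℝ} (hb : 0 ≤ b) {n : ℕ}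
    (hφ : ∀ r, 0 < r → ‖φ r‖ ^ 2 ≤ b ^ 2 * (1 + r) ^ n) :
    ∀ᵐ z ∂((volume : Measure E3).prod volume),
      ‖sandwich V φ z‖ ≤ b * ‖vWeight V n z.1 * vWeight V n z.2‖ := by
  filter_upwards [ae_fst_ne_snd] with z hz
  have hr : 0 < ‖z.1 - z.2‖ := norm_pos_iff.2 (sub_ne_zero.2 hz)
  refine abs_le_of_sq_le_sq' ?_ (by positivity) |>.2
  have h1 : 1 + ‖z.1 - z.2‖ ≤ (1 + ‖z.1‖) * (1 + ‖z.2‖) := by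
    nlinarith [norm_sub_le z.1 z.2, norm_nonneg z.1, norm_nonneg z.2]
  have hv : ∀ x, ‖(vFun V x : ℂ)‖ ^ 2 = |V x| := fun x => by
    rw [Complex.norm_real, Real.norm_eq_abs, sq_abs, sq, vFun_mul_self]
  rw [sandwich, norm_mul, norm_mul, mul_pow, mul_pow, hv, hv, mul_pow, Real.norm_eq_abs, sq_abs,
    mul_pow, vWeight, vWeight, Real.sq_sqrt (by positivity), Real.sq_sqrt (by positivity)]
  calc |V z.1| * ‖φ ‖z.1 - z.2‖‖ ^ 2 * |V z.2|
      ≤ |V z.1| * (b ^ 2 * ((1 + ‖z.1‖) * (1 + ‖z.2‖)) ^ n) * |V z.2| := by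
        gcongr
        exact (hφ _ hr).trans (by gcongr)
    _ = _ := by rw [mul_pow]; ring

theorem memLp_sandwich {φ : ℝ → ℂ} (hφm : Measurable φ) {b : ℝ} (hb : 0 ≤ b) {n : ℕ}
    (hF : Integrable (fun x => |V x| * (1 + ‖x‖) ^ n) volume)
    (hV : AEStronglyMeasurable V volume)
    (hφ : ∀ r, 0 < r → ‖φ r‖ ^ 2 ≤ b ^ 2 * (1 + r) ^ n) :
    MemLp (sandwich V φ) 2 ((volume : Measure E3).prod volume) := by
  have hv := aestronglyMeasurable_vFun hV
  refine (memLp_vWeight_prod hF).of_le_mul ?_ (norm_sandwich_le hb hφ)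
  refine (hv.comp_fst.mul ?_).mul hv.comp_snd
  exact (hφm.comp (by fun_prop : Measurable fun z : E3 × E3 => ‖z.1 - z.2‖)).aestronglyMeasurable

theorem norm_kernelOp_sandwich_le {φ : ℝ → ℂ} (hφm : Measurable φ) {b : ℝ} (hb : 0 ≤ b) {n : ℕ}
    (hF : Integrable (fun x => |V x| * (1 + ‖x‖) ^ n) volume)
    (hV : AEStronglyMeasurable V volume)
    (hφ : ∀ r, 0 < r → ‖φ r‖ ^ 2 ≤ b ^ 2 * (1 + r) ^ n) :
    ‖kernelOp (sandwich V φ)‖ ≤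
      b * (eLpNorm (fun z : E3 × E3 => vWeight V n z.1 * vWeight V n z.2) 2
        ((volume : Measure E3).prod volume)).toReal := by
  refine (norm_kernelOp_le (memLp_sandwich hφm hb hF hV hφ)).trans ?_
  have h := eLpNorm_le_mul_eLpNorm_of_ae_le_mul (norm_sandwich_le (V := V) hb hφ) 2
  refine (ENNReal.toReal_mono ?_ h).trans_eq ?_
  · exact ENNReal.mul_ne_top ENNReal.ofReal_ne_top (memLp_vWeight_prod hF).2.ne
  · rw [ENNReal.toReal_mul, ENNReal.toReal_ofReal hb]

end Potential

/-! ### The Birman–Schwinger principle -/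

/-- The radial profile of the Green kernel. -/
def greenRadial (μ : ℂ) (r : ℝ) : ℂ :=
  (Complex.exp (Complex.I * μ * r) - Complex.exp (-μ * r)) / (8 * Real.pi * μ ^ 2 * r)

/-- The operator `v (Δ² - μ⁴)⁻¹ v`. -/
def vRv (V : E3 → ℝ) (μ : ℂ) : L2 →L[ℂ] L2 := kernelOp (sandwich V (greenRadial μ))

/-- The kernel `v(x) G(x - y)` of `v (Δ² - μ⁴)⁻¹`, where `G` is the Green kernel. -/
def vRKernel (V : E3 → ℝ) (μ : ℂ) (z : E3 × E3) : ℂ := vFun V z.1 * greenKernel μ (z.1 - z.2)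

/-- The kernel `G(x - y) v(y)` of `(Δ² - μ⁴)⁻¹ v`, where `G` is the Green kernel. -/
def RvKernel (V : E3 → ℝ) (μ : ℂ) (z : E3 × E3) : ℂ := greenKernel μ (z.1 - z.2) * vFun V z.2

variable {V : E3 → ℝ}

theorem memLp_RvKernel (hre : 0 < μ.re) (him : 0 < μ.im) (hV : Integrable V volume) :
    MemLp (RvKernel V μ) 2 ((volume : Measure E3).prod volume) := by
  have hm : AEStronglyMeasurable (RvKernel V μ) ((volume : Measure E3).prod volume) :=
    ((measurable_greenKernel μ).comp (measurable_fst.sub measurable_snd)).aestronglyMeasurable.mul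
      (aestronglyMeasurable_vFun hV.1).comp_snd
  refine (memLp_two_iff_integrable_sq_norm hm).2 ?_
  have hK : Integrable (fun x => ‖greenKernel μ x‖ ^ 2) volume :=
    (memLp_two_iff_integrable_sq_norm (measurable_greenKernel μ).aestronglyMeasurable).1
      (memLp_two_greenKernel hre him)
  refine (Integrable.convolution_integrand (ContinuousLinearMap.mul ℝ ℝ) hV.norm hK).congr
    (Filter.Eventually.of_forall fun z => ?_)
  simp only [RvKernel, norm_mul, mul_pow, Complex.norm_real, Real.norm_eq_abs, sq_abs,
    ContinuousLinearMap.mul_apply']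
  rw [sq (vFun V z.2), vFun_mul_self, mul_comm]

theorem memLp_vRKernel (hre : 0 < μ.re) (him : 0 < μ.im) (hV : Integrable V volume) :
    MemLp (vRKernel V μ) 2 ((volume : Measure E3).prod volume) := by
  refine MemLp.ae_eq (Filter.Eventually.of_forall fun z => ?_)
    ((memLp_RvKernel hre him hV).comp_measurePreserving Measure.measurePreserving_swap)
  simp only [Function.comp_apply, RvKernel, vRKernel, Prod.fst_swap, Prod.snd_swap, greenKernel]
  rw [norm_sub_rev, mul_comm]

theorem memLp_vRv (hre : 0 < μ.re) (him : 0 < μ.im) (hV : Integrable V volume) :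
    MemLp (sandwich V (greenRadial μ)) 2 ((volume : Measure E3).prod volume) := by
  refine memLp_sandwich (n := 0) (b := ‖μ‖⁻¹) ?_ (by positivity) (by simpa using hV.abs) hV.1 ?_
  · unfold greenRadial; fun_prop
  · intro r hr
    have h := norm_greenKernel_le hre him (EuclideanSpace.single 0 r)
    have hg : greenKernel μ (EuclideanSpace.single 0 r) = greenRadial μ r := by
      simp [greenKernel, greenRadial, abs_of_pos hr]
    rw [hg] at h
    rw [pow_zero, mul_one]
    gcongr

theorem coeFn_vRKernel (hre : 0 < μ.re) (him : 0 < μ.im) (hV : Integrable V volume)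
    (f : L2) :
    kernelOp (vRKernel V μ) f =ᵐ[volume] fun x => vFun V x * freeResolvent (μ ^ 4) f x := by
  filter_upwards [coeFn_kernelOp (memLp_vRKernel hre him hV) f,
    coeFn_freeResolvent hre him f] with x h1 h2
  rw [h1, h2, greenConv, ← integral_const_mul]
  simp only [vRKernel, mul_assoc]

theorem coeFn_RvKernel (hre : 0 < μ.re) (him : 0 < μ.im) (hV : Integrable V volume)
    (g : L2) :
    kernelOp (RvKernel V μ) g =ᵐ[volume] greenConv μ fun y => vFun V y * g y := by
  filter_upwards [coeFn_kernelOp (memLp_RvKernel hre him hV) g] with x h1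
  rw [h1, greenConv]
  simp only [RvKernel, mul_assoc]

theorem coeFn_vRv (hre : 0 < μ.re) (him : 0 < μ.im) (hV : Integrable V volume)
    (g : L2) :
    vRv V μ g =ᵐ[volume] fun x => vFun V x * kernelOp (RvKernel V μ) g x := by
  filter_upwards [coeFn_kernelOp (memLp_vRv hre him hV) g, coeFn_RvKernel hre him hV g]
    with x h1 h2
  rw [vRv, h1, h2, greenConv, ← integral_const_mul]
  simp only [sandwich, mul_assoc, greenKernel, greenRadial]

/-- If `v g` coincides with a function `h ∈ L²`, then `((Δ² - μ⁴)⁻¹ v) g = (Δ² - μ⁴)⁻¹ h`. -/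
theorem RvKernel_eq_freeResolvent (hre : 0 < μ.re) (him : 0 < μ.im)
    (hV : Integrable V volume) {g h : L2} (hgh : h =ᵐ[volume] fun x => vFun V x * g x) :
    kernelOp (RvKernel V μ) g = freeResolvent (μ ^ 4) h := by
  refine Lp.ext ?_
  filter_upwards [coeFn_RvKernel hre him hV g, coeFn_freeResolvent hre him h] with x h1 h2
  rw [h1, h2, greenConv, greenConv]
  refine integral_congr_ae ?_
  filter_upwards [hgh] with y hy
  rw [hy]

theorem exists_bound_RvKernel (hre : 0 < μ.re) (him : 0 < μ.im) (hV : Integrable V volume)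
    (g : L2) :
    ∃ C : ℝ, ∀ᵐ x : E3, ‖kernelOp (RvKernel V μ) g x‖ ≤ C := by
  have hint : Integrable (fun y => (vFun V y : ℂ) * g y) volume :=
    MemLp.integrable_mul (memLp_vFun hV) (Lp.memLp g)
  refine ⟨∫ y, ‖μ‖⁻¹ * ‖(vFun V y : ℂ) * g y‖, ?_⟩
  filter_upwards [coeFn_RvKernel hre him hV g] with x hx
  rw [hx, greenConv]
  refine norm_integral_le_of_norm_le (hint.norm.const_mul _) (Filter.Eventually.of_forall fun y => ?_)
  rw [norm_mul]
  exact mul_le_mul_of_nonneg_right (norm_greenKernel_le hre him _) (norm_nonneg _)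

theorem coeFn_mulOp {m : E3 → ℂ} (f : (mulOp m).domain) :
    mulOp m f =ᵐ[volume] fun x => m x * (f : L2) x := MemLp.coeFn_toLp (memLp_of_mem_mulDomain f.2)

/-- The resolvent of `Δ² + V` given by the Birman–Schwinger formula, in terms of a candidate `B`
for the inverse of `U + v (Δ² - μ⁴)⁻¹ v`. -/
def perturbedResolvent (V : E3 → ℝ) (μ : ℂ) (B : L2 →L[ℂ] L2) : L2 →L[ℂ] L2 :=
  freeResolvent (μ ^ 4) - kernelOp (RvKernel V μ) ∘L B ∘L kernelOp (vRKernel V μ)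

theorem perturbedResolvent_apply (B : L2 →L[ℂ] L2) (f : L2) :
    perturbedResolvent V μ B f = freeResolvent (μ ^ 4) f -
      kernelOp (RvKernel V μ) (B (kernelOp (vRKernel V μ) f)) := rfl

theorem hamiltonian_apply (u : (hamiltonian V).domain) :
    hamiltonian V u = freeHamiltonian ⟨u, u.2.1⟩ + mulOp (fun x => (V x : ℂ)) ⟨u, u.2.2⟩ := rfl

/-- If `U + v (Δ² - μ⁴)⁻¹ v` is injective, then so is `Δ² + V - μ⁴`. -/
theorem eq_zero_of_hamiltonian_eq (hre : 0 < μ.re) (him : 0 < μ.im) (hV : Integrable V volume)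
    {B : L2 →L[ℂ] L2} (hB : B ∘L (U V + vRv V μ) = 1) (u : (hamiltonian V).domain)
    (hu : hamiltonian V u - μ ^ 4 • (u : L2) = 0) : (u : L2) = 0 := by
  have hR := isResolvent_freeResolvent (ofReal_ne_pow_four hre him)
  set h : L2 := mulOp (fun x => (V x : ℂ)) ⟨u, u.2.2⟩ with hh
  have hhx : h =ᵐ[volume] fun x => V x * (u : L2) x := coeFn_mulOp _
  have hu1 : (u : L2) = -freeResolvent (μ ^ 4) h := by
    rw [← hR.2 ⟨u, u.2.1⟩, ← map_neg]
    congr 1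
    rw [hamiltonian_apply, ← hh] at hu
    rw [← sub_eq_zero, ← hu]
    abel
  set g : L2 := U V (-kernelOp (vRKernel V μ) h) with hg
  have hUg : U V g = -kernelOp (vRKernel V μ) h := U_U hV.1 _
  have hvu : (-kernelOp (vRKernel V μ) h : L2) =ᵐ[volume] fun x => vFun V x * (u : L2) x := by
    filter_upwards [coeFn_vRKernel hre him hV h, Lp.coeFn_neg (kernelOp (vRKernel V μ) h),
      Lp.coeFn_neg (freeResolvent (μ ^ 4) h)] with x h1 h2 h3
    rw [h2, Pi.neg_apply, h1, hu1, h3, Pi.neg_apply, mul_neg]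
  have hvg : h =ᵐ[volume] fun x => vFun V x * g x := by
    filter_upwards [hhx, coeFn_U hV.1 (-kernelOp (vRKernel V μ) h), hvu] with x h1 h2 h3
    rw [h1, hg, h2, h3, ← uFun_mul_abs (V := V) x, ← vFun_mul_self]
    push_cast; ring
  have hA : kernelOp (RvKernel V μ) g = -(u : L2) := by
    rw [RvKernel_eq_freeResolvent hre him hV hvg, hu1, neg_neg]
  have hS : vRv V μ g = -U V g := by
    refine Lp.ext ?_
    rw [hUg, neg_neg]
    filter_upwards [coeFn_vRv hre him hV g, hvu, Lp.coeFn_neg (u : L2),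
      Lp.coeFn_neg (kernelOp (vRKernel V μ) h)] with x h1 h2 h3 h4
    rw [h1, hA, h3, Pi.neg_apply, mul_neg, ← h2, h4, Pi.neg_apply, neg_neg]
  have hg0 : g = 0 := by
    have := congrArg (fun T : L2 →L[ℂ] L2 => T g) hB
    simp only [ContinuousLinearMap.comp_apply, add_apply, hS, add_neg_cancel, map_zero] at this
    exact this.symm
  have hU0 : kernelOp (RvKernel V μ) g = 0 := by rw [hg0, map_zero]
  rw [hA, neg_eq_zero] at hU0
  exact hU0

theorem isResolvent_perturbedResolvent (hre : 0 < μ.re) (him : 0 < μ.im)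
    (hV : Integrable V volume) (hV2 : MemLp V 2 volume) {B : L2 →L[ℂ] L2}
    (hB₁ : (U V + vRv V μ) ∘L B = 1) (hB₂ : B ∘L (U V + vRv V μ) = 1) :
    IsResolvent (hamiltonian V) (μ ^ 4) (perturbedResolvent V μ B) := by
  have hR := isResolvent_freeResolvent (ofReal_ne_pow_four hre him)
  have main : ∀ f : L2, ∃ h : perturbedResolvent V μ B f ∈ (hamiltonian V).domain,
      hamiltonian V ⟨perturbedResolvent V μ B f, h⟩ - μ ^ 4 • perturbedResolvent V μ B f = f := by
    intro f
    set g := B (kernelOp (vRKernel V μ) f) with hg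
    set ψ := perturbedResolvent V μ B f with hψ
    have hψ' : ψ = freeResolvent (μ ^ 4) f - kernelOp (RvKernel V μ) g := rfl
    have hUg : U V g + vRv V μ g = kernelOp (vRKernel V μ) f := by
      have := congrArg (fun T : L2 →L[ℂ] L2 => T (kernelOp (vRKernel V μ) f)) hB₁
      simpa using this
    -- The function `ψ` is bounded, so that `V ψ` is square integrable; moreover `V ψ = v g`.
    have hbdd : ∃ C : ℝ, ∀ᵐ x : E3, ‖ψ x‖ ≤ C := by
      obtain ⟨C, hC⟩ := exists_bound_RvKernel hre him hV g
      refine ⟨(eLpNorm (greenKernel μ) 2 volume).toReal * ‖f‖ + C, ?_⟩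
      filter_upwards [hC, coeFn_freeResolvent hre him f,
        Lp.coeFn_sub (freeResolvent (μ ^ 4) f) (kernelOp (RvKernel V μ) g)] with x h1 h2 h3
      rw [hψ', h3, Pi.sub_apply, h2]
      exact (norm_sub_le _ _).trans (add_le_add (norm_greenConv_le hre him f x) h1)
    have hdom : ψ ∈ (mulOp fun x => (V x : ℂ)).domain := by
      obtain ⟨C, hC⟩ := hbdd
      refine MemLp.of_le_mul (c := C) hV2
        ((Complex.continuous_ofReal.comp_aestronglyMeasurable hV.1).mul
          (Lp.aestronglyMeasurable ψ)) ?_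
      filter_upwards [hC] with x hx
      rw [norm_mul, mul_comm, Complex.norm_real]
      exact mul_le_mul_of_nonneg_right hx (norm_nonneg _)
    set h : L2 := mulOp (fun x => (V x : ℂ)) ⟨ψ, hdom⟩ with hh
    have hvg : h =ᵐ[volume] fun x => vFun V x * g x := by
      filter_upwards [coeFn_mulOp (m := fun x => (V x : ℂ)) ⟨ψ, hdom⟩, coeFn_vRv hre him hV g,
        coeFn_U hV.1 g, coeFn_vRKernel hre him hV f, Lp.coeFn_add (U V g) (vRv V μ g),
        Lp.coeFn_sub (freeResolvent (μ ^ 4) f) (kernelOp (RvKernel V μ) g)] with x h1 h2 h3 h4 h5 h6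
      rw [hUg, h4, Pi.add_apply, h2, h3] at h5
      rw [h1]
      rw [hψ', h6, Pi.sub_apply]
      have hu1 : (uFun V x : ℂ) * uFun V x = 1 := by exact_mod_cast uFun_mul_self x
      have hV1 : (V x : ℂ) = uFun V x * (vFun V x * vFun V x) := by
        have := uFun_mul_abs (V := V) x
        rw [← vFun_mul_self] at this
        exact_mod_cast this.symm
      rw [hV1]
      linear_combination ((uFun V x : ℂ) * vFun V x) * h5 + (vFun V x * g x : ℂ) * hu1
    have hψ2 : ψ = freeResolvent (μ ^ 4) (f - h) := by
      rw [map_sub, ← RvKernel_eq_freeResolvent hre him hV hvg, hψ']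
    obtain ⟨hmem, heq⟩ := hR.1 (f - h)
    have hmem' : ψ ∈ freeHamiltonian.domain := by rw [hψ2]; exact hmem
    have heq' : freeHamiltonian ⟨ψ, hmem'⟩ - μ ^ 4 • ψ = f - h := by
      rw [← heq]
      congr 2
      exact Subtype.ext hψ2
    refine ⟨⟨hmem', hdom⟩, ?_⟩
    rw [hamiltonian_apply, add_sub_right_comm]
    change freeHamiltonian ⟨ψ, hmem'⟩ - μ ^ 4 • ψ + h = f
    rw [heq', sub_add_cancel]
  refine ⟨main, fun u => ?_⟩
  obtain ⟨hd, he⟩ := main (hamiltonian V u - μ ^ 4 • (u : L2))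
  set R := perturbedResolvent V μ B (hamiltonian V u - μ ^ 4 • (u : L2))
  have h0 := eq_zero_of_hamiltonian_eq hre him hV hB₂ (⟨R, hd⟩ - u) (by
    rw [LinearPMap.map_sub, Submodule.coe_sub, smul_sub, sub_sub_sub_comm, he, sub_self])
  exact sub_eq_zero.1 h0

/-- The weighted resolvent `w (Δ² + V - μ⁴)⁻¹ w` is `U` minus the inverse of
`U + v (Δ² - μ⁴)⁻¹ v`. -/
theorem isWeighted_perturbedResolvent (hre : 0 < μ.re) (him : 0 < μ.im)
    (hV : Integrable V volume) {B : L2 →L[ℂ] L2}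
    (hB₁ : (U V + vRv V μ) ∘L B = 1) (hB₂ : B ∘L (U V + vRv V μ) = 1) :
    IsWeighted (wFun V) (perturbedResolvent V μ B) (U V - B) := by
  have hwm : AEStronglyMeasurable (fun x => (wFun V x : ℂ)) volume := by
    refine ((aestronglyMeasurable_uFun hV.1).mul (aestronglyMeasurable_vFun hV.1)).congr
      (Filter.Eventually.of_forall fun x => ?_)
    simp [wFun]
  refine ⟨dense_mulDomain hwm, fun f => ?_⟩
  set F : L2 := mulOp (fun x => (wFun V x : ℂ)) f with hF
  have hFv : F =ᵐ[volume] fun x => vFun V x * U V f x := by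
    filter_upwards [coeFn_mulOp f, coeFn_U hV.1 (f : L2)] with x h1 h2
    rw [hF, h1, h2, wFun]
    push_cast; ring
  have h1 : freeResolvent (μ ^ 4) F = kernelOp (RvKernel V μ) (U V f) :=
    (RvKernel_eq_freeResolvent hre him hV hFv).symm
  have h2 : kernelOp (vRKernel V μ) F = vRv V μ (U V f) := by
    refine Lp.ext ?_
    filter_upwards [coeFn_vRKernel hre him hV F, coeFn_vRv hre him hV (U V f)] with x e1 e2
    rw [e1, e2, h1]
  have h3 : B (vRv V μ (U V f)) = U V f - B f := by
    have := congrArg (fun T : L2 →L[ℂ] L2 => T (U V f)) hB₂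
    simp only [ContinuousLinearMap.comp_apply, add_apply, U_U hV.1, map_add] at this
    exact eq_sub_of_add_eq' this
  have h4 : perturbedResolvent V μ B F = kernelOp (RvKernel V μ) (B f) := by
    rw [perturbedResolvent_apply, h2, h3, h1, map_sub, sub_sub_cancel]
  have h5 : vRv V μ (B f) = f - U V (B f) := by
    have := congrArg (fun T : L2 →L[ℂ] L2 => T f) hB₁
    simp only [ContinuousLinearMap.comp_apply, add_apply] at this
    exact eq_sub_of_add_eq' this
  have h6 : (fun x => (wFun V x : ℂ) * perturbedResolvent V μ B F x) =ᵐ[volume]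
      ((U V - B) f : L2) := by
    have e : (U V - B) f = U V (vRv V μ (B f)) := by
      rw [h5, map_sub, U_U hV.1]; rfl
    rw [e, h4]
    filter_upwards [coeFn_U hV.1 (vRv V μ (B f)), coeFn_vRv hre him hV (B f)] with x e1 e2
    rw [e1, e2, wFun]
    push_cast; ring
  refine ⟨(memLp_congr_ae h6).2 (Lp.memLp _), Lp.ext ?_⟩
  exact (coeFn_mulOp _).trans h6

/-! ### The expansion of `U + v (Δ² - μ⁴)⁻¹ v` -/

/-- The coefficient of `μ^j` in the expansion of the radial profile of the Green kernel. -/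
def greenCoeff (j : ℕ) (r : ℝ) : ℂ :=
  -((Complex.I ^ j + (-1) ^ j) / (8 * Real.pi * (j + 2).factorial)) * ((r ^ (j + 1) : ℝ) : ℂ)

/-- The remainder in the expansion of the radial profile of the Green kernel up to order `μ^p`. -/
def greenRem (p : ℕ) (μ : ℂ) (r : ℝ) : ℂ :=
  greenRadial μ r - ((1 + Complex.I) / (8 * Real.pi) * μ⁻¹
    + ∑ j ∈ Finset.range (p + 1), μ ^ j * greenCoeff j r)

/-- The remainder of the Green kernel is a difference of Taylor remainders of the exponential. -/
theorem greenRem_eq (p : ℕ) (hμ : μ ≠ 0) {r : ℝ} (hr : 0 < r) :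
    greenRem p μ r = (expRem (p + 3) (Complex.I * μ * r) - expRem (p + 3) (-μ * r))
      / (8 * Real.pi * μ ^ 2 * r) := by
  have hpi : (Real.pi : ℂ) ≠ 0 := Complex.ofReal_ne_zero.2 Real.pi_ne_zero
  have hrc : (r : ℂ) ≠ 0 := Complex.ofReal_ne_zero.2 hr.ne'
  have hsum : (∑ n ∈ Finset.range (p + 3), (Complex.I * μ * r) ^ n / n.factorial)
      - ∑ n ∈ Finset.range (p + 3), (-μ * r) ^ n / n.factorial =
      (8 * Real.pi * μ ^ 2 * r) * ((1 + Complex.I) / (8 * Real.pi) * μ⁻¹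
        + ∑ j ∈ Finset.range (p + 1), μ ^ j * greenCoeff j r) := by
    rw [← Finset.sum_sub_distrib, Finset.sum_range_succ', Finset.sum_range_succ', mul_add,
      Finset.mul_sum]
    have e1 : ∀ j : ℕ, (Complex.I * μ * r) ^ (j + 1 + 1) / (j + 1 + 1).factorial
        - (-μ * r) ^ (j + 1 + 1) / (j + 1 + 1).factorial =
        8 * Real.pi * μ ^ 2 * r * (μ ^ j * greenCoeff j r) := by
      intro j
      have hf : ((j + 2).factorial : ℂ) ≠ 0 := by exact_mod_cast (j + 2).factorial_ne_zero
      rw [greenCoeff, mul_pow, mul_pow, mul_pow, pow_add Complex.I, pow_add Complex.I,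
        neg_pow μ, pow_add (-1 : ℂ), pow_add (-1 : ℂ)]
      push_cast
      field_simp
      rw [Complex.I_sq]
      ring
    rw [Finset.sum_congr rfl fun j _ => e1 j]
    simp only [zero_add, pow_one, pow_zero, Nat.factorial_one, Nat.factorial_zero]
    field_simp
    push_cast
    ring
  have hden : (8 * Real.pi * μ ^ 2 * r : ℂ) ≠ 0 := by simp [hμ, hpi, hr.ne']
  rw [eq_div_iff hden, greenRem, sub_mul, greenRadial, div_mul_cancel₀ _ hden, expRem, expRem,
    mul_comm _ (8 * Real.pi * μ ^ 2 * r : ℂ), ← hsum]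
  ring

/-- The squared Taylor remainders of half-integer order are of size `(|μ| r)^{2p+5}`; dividing by
`|8πμ²r|²` leaves `|μ|^{2p+1} r^{2p+3}`. -/
theorem norm_greenRem_sq_le (p : ℕ) (hre : 0 < μ.re) (him : 0 < μ.im) {r : ℝ} (hr : 0 < r) :
    ‖greenRem p μ r‖ ^ 2 ≤ (‖μ‖ ^ p * √‖μ‖) ^ 2 * (1 + r) ^ (2 * p + 3) := by
  have hμ : μ ≠ 0 := fun h => by simp [h] at hre
  have hμ' : 0 < ‖μ‖ := norm_pos_iff.2 hμ
  have h1 := norm_expRem_sq_le (p + 2) (re_I_mul_nonpos him r hr.le)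
  have h2 := norm_expRem_sq_le (p + 2) (re_neg_mul_nonpos hre r hr.le)
  simp only [norm_mul, norm_neg, Complex.norm_I, one_mul, Complex.norm_real,
    Real.norm_of_nonneg hr.le] at h1 h2
  have hden : ‖(8 * Real.pi * μ ^ 2 * r : ℂ)‖ = 8 * Real.pi * ‖μ‖ ^ 2 * r := by
    simp [abs_of_pos Real.pi_pos, abs_of_pos hr]
  rw [greenRem_eq p hμ hr, norm_div, hden, div_pow, div_le_iff₀ (by positivity), mul_pow,
    Real.sq_sqrt hμ'.le]
  set a := ‖expRem (p + 3) (Complex.I * μ * r)‖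
  set b := ‖expRem (p + 3) (-μ * r)‖
  have h3 : ‖expRem (p + 3) (Complex.I * μ * r) - expRem (p + 3) (-μ * r)‖ ^ 2 ≤ (a + b) ^ 2 := by
    gcongr
    exact norm_sub_le _ _
  have h4 : (‖μ‖ * r) ^ (2 * (p + 2) + 1) * 8 ≤ (‖μ‖ ^ p) ^ 2 * ‖μ‖ * (1 + r) ^ (2 * p + 3)
      * (8 * Real.pi * ‖μ‖ ^ 2 * r) ^ 2 := by
    have e : (‖μ‖ * r) ^ (2 * (p + 2) + 1) * 8 =
        (‖μ‖ ^ p) ^ 2 * ‖μ‖ * r ^ (2 * p + 3) * (8 * (‖μ‖ ^ 2 * r) ^ 2) := by ring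
    rw [e]
    have h5 : (8 : ℝ) * (‖μ‖ ^ 2 * r) ^ 2 ≤ (8 * Real.pi * ‖μ‖ ^ 2 * r) ^ 2 := by
      have h6 : (8 * Real.pi * ‖μ‖ ^ 2 * r) ^ 2 = (64 * Real.pi ^ 2) * (‖μ‖ ^ 2 * r) ^ 2 := by ring
      rw [h6]
      gcongr
      nlinarith [Real.pi_gt_three]
    gcongr
    linarith
  nlinarith [sq_nonneg (a - b)]

theorem norm_greenCoeff_sq_le (j : ℕ) {n : ℕ} (hn : 2 * j + 2 ≤ n) {r : ℝ} (hr : 0 < r) :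
    ‖greenCoeff j r‖ ^ 2 ≤ 1 ^ 2 * (1 + r) ^ n := by
  have h1 : ‖(Complex.I ^ j + (-1) ^ j) / (8 * Real.pi * (j + 2).factorial)‖ ≤ 1 := by
    have hden : ‖(8 * Real.pi * (j + 2).factorial : ℂ)‖ = 8 * Real.pi * (j + 2).factorial := by
      simp [abs_of_pos Real.pi_pos]
    have hf : (1 : ℝ) ≤ (j + 2).factorial := by exact_mod_cast (j + 2).factorial_pos
    rw [norm_div, hden, div_le_one (by positivity)]
    refine (norm_add_le _ _).trans ?_
    simp only [norm_pow, Complex.norm_I, norm_neg, norm_one, one_pow]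
    nlinarith [Real.pi_gt_three]
  rw [greenCoeff, norm_mul, norm_neg, Complex.norm_real, Real.norm_of_nonneg (by positivity),
    mul_pow, ← pow_mul]
  refine mul_le_mul (by gcongr) ?_ (by positivity) (by norm_num)
  calc r ^ ((j + 1) * 2) ≤ (1 + r) ^ ((j + 1) * 2) := by gcongr; linarith
    _ ≤ (1 + r) ^ n := pow_le_pow_right₀ (by linarith) (by omega)

theorem vG₀v_eq (V : E3 → ℝ) : vG₀v V = kernelOp (sandwich V (greenCoeff 0)) := by
  rw [vG₀v]
  congr 1
  ext z
  simp only [sandwich, greenCoeff, G₀]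
  push_cast
  rw [Nat.factorial_two]
  push_cast
  ring

theorem M_succ_eq (V : E3 → ℝ) (j : ℕ) :
    M V (j + 1) = kernelOp (sandwich V (greenCoeff (j + 1))) := by
  rw [M]
  congr 1
  ext z
  simp only [sandwich, greenCoeff]
  push_cast
  ring

theorem P_eq_zero_of_α_eq_zero (h : α V = 0) : P V = 0 := by
  have hv : vVec V = 0 := by simpa [α] using h
  rw [P, hv]
  ext1 f
  simp

theorem memLp_sandwich_const (hV : Integrable V volume) (a : ℂ) :
    MemLp (sandwich V fun _ => a) 2 ((volume : Measure E3).prod volume) :=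
  memLp_sandwich measurable_const (norm_nonneg a) (n := 0) (by simpa using hV.abs) hV.1
    fun r _ => by simp

/-- A constant profile gives the rank-one operator `a ⟨v, ·⟩ v`; for `v = 0` both sides vanish. -/
theorem kernelOp_sandwich_const (hV : Integrable V volume) (a : ℂ) :
    kernelOp (sandwich V fun _ => a) = (a * α V) • P V := by
  have h1 : kernelOp (sandwich V fun _ => a) =
      a • (innerSL ℂ (vVec V)).smulRight (vVec V) := by
    ext1 f
    refine Lp.ext ?_
    have hin : inner ℂ (vVec V) f = ∫ y, (vFun V y : ℂ) * f y := by
      rw [L2.inner_def]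
      refine integral_congr_ae ?_
      filter_upwards [coeFn_vVec hV] with y hy
      rw [hy]
      simp [mul_comm]
    have h2 : (a • (innerSL ℂ (vVec V)).smulRight (vVec V)) f =
        (a * ∫ y, (vFun V y : ℂ) * f y) • vVec V := by
      rw [← hin, mul_smul]; rfl
    rw [h2]
    filter_upwards [coeFn_kernelOp (memLp_sandwich_const hV a) f, coeFn_vVec hV,
      Lp.coeFn_smul (a * ∫ y, (vFun V y : ℂ) * f y) (vVec V)] with x e1 e2 e3
    rw [e1, e3, Pi.smul_apply, e2, smul_eq_mul, ← integral_const_mul, ← integral_mul_const]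
    refine integral_congr_ae (Filter.Eventually.of_forall fun y => ?_)
    simp only [sandwich]
    ring
  rw [h1]
  by_cases hα : α V = 0
  · have hv : vVec V = 0 := by simpa [α] using hα
    rw [P_eq_zero_of_α_eq_zero hα, hv]
    ext1 f
    simp
  · rw [P, smul_smul, mul_assoc, mul_inv_cancel₀ (Complex.ofReal_ne_zero.2 hα), mul_one]

/-- The expansion of `U + v (Δ² - μ⁴)⁻¹ v` at `μ = 0`. The decay of the potential makes the kernel
with `|x - y|^{p + 3/2}` Hilbert–Schmidt, which bounds the remainder by `|μ|^{p + 1/2}`. -/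
theorem exists_norm_sub_expansion_le {p : ℕ} (hV : Integrable V volume)
    (hF : Integrable (fun x => |V x| * (1 + ‖x‖) ^ (2 * p + 3)) volume) :
    ∃ K : ℝ, ∀ μ : ℂ, 0 < μ.re → 0 < μ.im →
      ‖(U V + vRv V μ) - ((c V * μ⁻¹) • P V + ∑ j ∈ Finset.range (p + 1), μ ^ j • M V j)‖ ≤
        K * (‖μ‖ ^ p * √‖μ‖) := by
  refine ⟨(eLpNorm (fun z : E3 × E3 => vWeight V (2 * p + 3) z.1 * vWeight V (2 * p + 3) z.2) 2
        ((volume : Measure E3).prod volume)).toReal, fun μ hre him => ?_⟩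
  have hcm : ∀ j, Measurable (greenCoeff j) := fun j => by unfold greenCoeff; fun_prop
  have hgm : Measurable (greenRadial μ) := by unfold greenRadial; fun_prop
  have hrm : Measurable (greenRem p μ) := by
    unfold greenRem
    exact hgm.sub (measurable_const.add (Finset.measurable_fun_sum _ fun j _ =>
      measurable_const.mul (hcm j)))
  have hb : 0 ≤ ‖μ‖ ^ p * √‖μ‖ := by positivity
  have hrem := fun (r : ℝ) (hr : 0 < r) => norm_greenRem_sq_le p hre him hr
  have mrem := memLp_sandwich hrm hb hF hV.1 hrem
  have mconst := memLp_sandwich_const hV ((1 + Complex.I) / (8 * Real.pi) * μ⁻¹)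
  have mcoeff : ∀ j ∈ Finset.range (p + 1),
      MemLp (sandwich V (greenCoeff j)) 2 ((volume : Measure E3).prod volume) := fun j hj =>
    memLp_sandwich (hcm j) zero_le_one hF hV.1 fun r hr =>
      norm_greenCoeff_sq_le j (by have := Finset.mem_range.1 hj; omega) hr
  -- The profiles add up pointwise, also on the diagonal, by the definition of the remainder.
  have hdec : sandwich V (greenRadial μ) = sandwich V (greenRem p μ)
      + (sandwich V (fun _ => (1 + Complex.I) / (8 * Real.pi) * μ⁻¹)
        + ∑ j ∈ Finset.range (p + 1), μ ^ j • sandwich V (greenCoeff j)) := by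
    ext z
    simp only [Pi.add_apply, Finset.sum_apply, Pi.smul_apply, smul_eq_mul, sandwich, greenRem]
    have e : ∑ j ∈ Finset.range (p + 1), μ ^ j *
        (vFun V z.1 * greenCoeff j ‖z.1 - z.2‖ * vFun V z.2) =
        vFun V z.1 * (∑ j ∈ Finset.range (p + 1), μ ^ j * greenCoeff j ‖z.1 - z.2‖)
          * vFun V z.2 := by
      rw [Finset.mul_sum, Finset.sum_mul]
      exact Finset.sum_congr rfl fun j _ => by ring
    rw [e]
    ring
  have hS : vRv V μ = kernelOp (sandwich V (greenRem p μ)) + ((c V * μ⁻¹) • P V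
      + ∑ j ∈ Finset.range (p + 1), μ ^ j • kernelOp (sandwich V (greenCoeff j))) := by
    have mc := fun j hj => (mcoeff j hj).const_smul (μ ^ j)
    rw [vRv, hdec, kernelOp_add mrem (mconst.add (memLp_finsetSum' _ mc)),
      kernelOp_add mconst (memLp_finsetSum' _ mc), kernelOp_sum _ mc, kernelOp_sandwich_const hV,
      Finset.sum_congr rfl fun j hj => kernelOp_const_smul (μ ^ j) (mcoeff j hj)]
    congr 3
    rw [c]
    ring
  have hM : ∑ j ∈ Finset.range (p + 1), μ ^ j • M V j =
      U V + ∑ j ∈ Finset.range (p + 1), μ ^ j • kernelOp (sandwich V (greenCoeff j)) := by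
    rw [Finset.sum_range_succ', Finset.sum_range_succ']
    simp only [M_succ_eq, pow_zero, one_smul]
    rw [M, vG₀v_eq]
    abel
  have hE : (U V + vRv V μ) - ((c V * μ⁻¹) • P V + ∑ j ∈ Finset.range (p + 1), μ ^ j • M V j) =
      kernelOp (sandwich V (greenRem p μ)) := by
    rw [hM, hS]; abel
  rw [hE, mul_comm]
  exact norm_kernelOp_sandwich_le hrm hb hF hV.1 hrem

/-! ### The algebraic relations of `P`, `Q` and `Q m₀⁻¹ Q` -/

theorem P_mul_P (V : E3 → ℝ) : P V * P V = P V := by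
  by_cases hα : α V = 0
  · rw [P_eq_zero_of_α_eq_zero hα, mul_zero]
  · have hα' : (α V : ℂ) ≠ 0 := Complex.ofReal_ne_zero.2 hα
    have hin : inner ℂ (vVec V) (vVec V) = (α V : ℂ) := by
      rw [inner_self_eq_norm_sq_to_K, α]; push_cast; rfl
    have hP : ∀ f, P V f = ((α V : ℂ)⁻¹ * inner ℂ (vVec V) f) • vVec V := fun f => by
      rw [mul_smul]; rfl
    ext1 f
    rw [mul_apply_eq_comp, hP f, map_smul, hP (vVec V), hin, inv_mul_cancel₀ hα',
      one_smul]

theorem Q_mul_Q (V : E3 → ℝ) : Q V * Q V = Q V := by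
  have h : (1 - P V) * (1 - P V) = 1 - P V - P V + P V * P V := by noncomm_ring
  rw [Q, h, P_mul_P, sub_add_cancel]

theorem Q_apply_of_mem (V : E3 → ℝ) (y : QL2 V) : Q V (y : L2) = y := by
  obtain ⟨_, f, rfl⟩ := y
  exact congrArg (fun T : L2 →L[ℂ] L2 => T f) (Q_mul_Q V)

theorem coe_toQL2 (V : E3 → ℝ) (f : L2) : (toQL2 V f : L2) = Q V f := rfl

theorem toQL2_Q (V : E3 → ℝ) (f : L2) : toQL2 V (Q V f) = toQL2 V f :=
  Subtype.ext (congrArg (fun T : L2 →L[ℂ] L2 => T f) (Q_mul_Q V))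

theorem Q_mul_Qm₀invQ (V : E3 → ℝ) : Q V * Qm₀invQ V = Qm₀invQ V := by
  ext1 f
  exact Q_apply_of_mem V _

theorem Qm₀invQ_mul_Q (V : E3 → ℝ) : Qm₀invQ V * Q V = Qm₀invQ V := by
  ext1 f
  change ((Ring.inverse (m₀ V) (toQL2 V (Q V f)) : QL2 V) : L2) = _
  rw [toQL2_Q]
  rfl

theorem Q_mul_M_mul_Qm₀invQ (h : ZeroIsRegular V) : Q V * M V 0 * Qm₀invQ V = Q V := by
  ext1 f
  have h1 := congrArg (fun T : QL2 V →L[ℂ] QL2 V => T (toQL2 V f)) (Ring.mul_inverse_cancel _ h)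
  have h2 := congrArg Subtype.val h1
  simp only [mul_apply_eq_comp, one_apply_eq_self] at h2
  rw [coe_toQL2] at h2
  rw [← h2, M]
  change Q V ((U V + vG₀v V) (Ring.inverse (m₀ V) (toQL2 V f) : QL2 V)) =
    Q V ((U V + vG₀v V) (Q V (Ring.inverse (m₀ V) (toQL2 V f) : QL2 V)))
  rw [Q_apply_of_mem]

theorem Qm₀invQ_mul_M_mul_Q (h : ZeroIsRegular V) : Qm₀invQ V * M V 0 * Q V = Q V := by
  ext1 f
  have h1 := congrArg (fun T : QL2 V →L[ℂ] QL2 V => T (toQL2 V f)) (Ring.inverse_mul_cancel _ h)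
  have h2 := congrArg Subtype.val h1
  simp only [mul_apply_eq_comp, one_apply_eq_self] at h2
  rw [coe_toQL2] at h2
  rw [← h2, M]
  have h3 : m₀ V (toQL2 V f) = toQL2 V ((U V + vG₀v V) (Q V f)) := by
    change toQL2 V ((U V + vG₀v V) (Q V (toQL2 V f : L2))) = _
    rw [Q_apply_of_mem]
    rfl
  rw [h3]
  rfl

theorem N_succ (V : E3 → ℝ) (k : ℕ) :
    N V (k + 1) = (1 - N V 0 * M V 0) * ((c V)⁻¹ • (P V * ((if k = 0 then 1 else 0)
        - ∑ l ∈ Finset.range (k + 1), M V (k - l) * N V l)))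
      - N V 0 * ∑ l ∈ Finset.range (k + 1), M V (k + 1 - l) * N V l := by
  rw [N, N, Finset.sum_range, Finset.sum_range]
  rfl

/-! ### Decay of the potential -/

theorem aestronglyMeasurable_of_weighted {κ : ℝ}
    (hV : MemLp (fun x : E3 => (1 + ‖x‖ ^ 2) ^ (κ / 2) * V x) 2 volume) :
    AEStronglyMeasurable V volume := by
  have hc : Continuous fun x : E3 => (1 + ‖x‖ ^ 2) ^ (-(κ / 2)) :=
    (by fun_prop : Continuous fun x : E3 => 1 + ‖x‖ ^ 2).rpow_const
      fun x => Or.inl (by positivity)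
  refine (hc.aestronglyMeasurable.mul hV.1).congr (Filter.Eventually.of_forall fun x => ?_)
  have hpos : (0 : ℝ) < 1 + ‖x‖ ^ 2 := by positivity
  simp only [Pi.mul_apply]
  rw [← mul_assoc, ← Real.rpow_add hpos, neg_add_cancel, Real.rpow_zero, one_mul]

theorem memLp_two_of_weighted {κ : ℝ} (hκ : 0 ≤ κ)
    (hV : MemLp (fun x : E3 => (1 + ‖x‖ ^ 2) ^ (κ / 2) * V x) 2 volume) : MemLp V 2 volume := by
  refine hV.of_le (aestronglyMeasurable_of_weighted hV) (Filter.Eventually.of_forall fun x => ?_)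
  have h : 1 ≤ (1 + ‖x‖ ^ 2) ^ (κ / 2) :=
    Real.one_le_rpow (by linarith [sq_nonneg ‖x‖]) (by linarith)
  rw [norm_mul, Real.norm_of_nonneg (zero_le_one.trans h)]
  exact le_mul_of_one_le_left (norm_nonneg _) h

theorem integrable_of_weighted {κ : ℝ} {n : ℕ} (hκ : n + 3 / 2 < κ)
    (hV : MemLp (fun x : E3 => (1 + ‖x‖ ^ 2) ^ (κ / 2) * V x) 2 volume) :
    Integrable (fun x => |V x| * (1 + ‖x‖) ^ n) volume := by
  have hVm := aestronglyMeasurable_of_weighted hV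
  have hcont : Continuous fun x : E3 => (1 + ‖x‖ ^ 2) ^ ((n - κ) / 2) :=
    (by fun_prop : Continuous fun x : E3 => 1 + ‖x‖ ^ 2).rpow_const
      fun x => Or.inl (by positivity)
  have hw : MemLp (fun x : E3 => (1 + ‖x‖ ^ 2) ^ ((n - κ) / 2)) 2 volume := by
    refine (memLp_two_iff_integrable_sq hcont.aestronglyMeasurable).2 ?_
    have h : Integrable (fun x : E3 => (1 + ‖x‖ ^ 2) ^ (-(2 * (κ - n)) / 2)) volume :=
      integrable_rpow_neg_one_add_norm_sq (by
        rw [finrank_euclideanSpace_fin]; push_cast; linarith)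
    refine h.congr (Filter.Eventually.of_forall fun x => ?_)
    simp only
    rw [← Real.rpow_mul_natCast (by positivity)]
    congr 1
    push_cast; ring
  refine ((hw.integrable_mul hV).norm.const_mul (2 ^ n)).mono' ?_
    (Filter.Eventually.of_forall fun x => ?_)
  · exact (continuous_abs.comp_aestronglyMeasurable hVm).mul
      (by fun_prop : Continuous fun x : E3 => (1 + ‖x‖) ^ n).aestronglyMeasurable
  · have hpos : (0 : ℝ) < 1 + ‖x‖ ^ 2 := by positivity
    have h1 : 1 + ‖x‖ ≤ 2 * √(1 + ‖x‖ ^ 2) := by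
      have h2 : 1 ≤ √(1 + ‖x‖ ^ 2) := Real.one_le_sqrt.2 (by linarith [sq_nonneg ‖x‖])
      have h3 : ‖x‖ ≤ √(1 + ‖x‖ ^ 2) := Real.le_sqrt_of_sq_le (by linarith)
      linarith
    have h4 : √(1 + ‖x‖ ^ 2) ^ n = (1 + ‖x‖ ^ 2) ^ ((n - κ) / 2) * (1 + ‖x‖ ^ 2) ^ (κ / 2) := by
      rw [← Real.rpow_add hpos, Real.sqrt_eq_rpow, ← Real.rpow_mul_natCast hpos.le]
      congr 1
      ring
    rw [Real.norm_of_nonneg (by positivity), Pi.mul_apply, ← mul_assoc, norm_mul, ← h4,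
      Real.norm_of_nonneg (by positivity), Real.norm_eq_abs, ← mul_assoc, ← mul_pow, mul_comm]
    gcongr

/-! ### The expansion of the weighted resolvent -/

/-- The remainder in the expansion of the weighted resolvent, divided by `μ^p`. -/
def weightedRem (V : E3 → ℝ) (p : ℕ) (μ : ℂ) : L2 →L[ℂ] L2 :=
  (μ ^ p)⁻¹ • (Qm₀invQ V - ∑ j ∈ Finset.Icc 1 (p - 1), μ ^ j • M' V j
    - Ring.inverse (U V + vRv V μ))

end FourthOrder

end

theorem mainTheorem6 (V : FourthOrder.E3 → ℝ) (κ : ℝ)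
    (hV : MemLp (fun x : FourthOrder.E3 => (1 + ‖x‖ ^ 2) ^ (κ / 2) * V x) 2 volume)
    (p : ℕ) (hp : IsGreatest {n : ℕ | 2 * (n : ℝ) + 5 < κ} p)
    (hreg : FourthOrder.ZeroIsRegular V) :
    ∃ μ₀ : ℝ, 0 < μ₀ ∧ ∃ (C : ℝ) (𝔑 : ℂ → (FourthOrder.L2 →L[ℂ] FourthOrder.L2)),
      ∀ μ : ℂ, 0 < μ.re → 0 < μ.im → ‖μ‖ ≤ μ₀ →
        ‖𝔑 μ‖ ≤ C ∧
        ∃ R : FourthOrder.L2 →L[ℂ] FourthOrder.L2,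
          FourthOrder.IsResolvent (FourthOrder.hamiltonian V) (μ ^ 4) R ∧
          FourthOrder.IsWeighted (FourthOrder.wFun V) R
            (FourthOrder.U V - FourthOrder.Qm₀invQ V
              + ∑ j ∈ Finset.Icc 1 (p - 1), μ ^ j • FourthOrder.M' V j + μ ^ p • 𝔑 μ) := by
  open FourthOrder in
  have hκ : 2 * (p : ℝ) + 5 < κ := hp.1
  have hp0 : (0 : ℝ) ≤ p := p.cast_nonneg
  have hF : Integrable (fun x => |V x| * (1 + ‖x‖) ^ (2 * p + 3)) volume :=
    integrable_of_weighted (by push_cast; linarith) hV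
  have hV1 : Integrable V volume := by
    have h := integrable_of_weighted (n := 0) (by push_cast; linarith) hV
    simp only [pow_zero, mul_one] at h
    exact (integrable_norm_iff (aestronglyMeasurable_of_weighted hV)).1 h
  have hV2 := memLp_two_of_weighted (by linarith) hV
  obtain ⟨K, hK⟩ := exists_norm_sub_expansion_le hV1 hF
  -- If `V = 0` almost everywhere, then `c = c⁻¹ = 0`, but also `P = 0`.
  have hcd : ((c V)⁻¹ * c V) • P V = P V := by
    by_cases hα : α V = 0
    · rw [P_eq_zero_of_α_eq_zero hα, smul_zero]
    · have hc : c V ≠ 0 := by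
        have h1 : (1 + Complex.I) ≠ 0 := fun h => by simpa using congrArg Complex.re h
        simp [c, h1, hα, Real.pi_ne_zero]
      rw [inv_mul_cancel₀ hc, one_smul]
  have hN0 : N V 0 = Qm₀invQ V := by rw [N]
  have hPN : P V * N V 0 = 0 := by
    have h := Q_mul_Qm₀invQ V
    rw [Q, sub_mul, one_mul] at h
    rw [hN0]
    exact sub_eq_self.1 h
  have hNP : N V 0 * P V = 0 := by
    have h := Qm₀invQ_mul_Q V
    rw [Q, mul_sub, mul_one] at h
    rw [hN0]
    exact sub_eq_self.1 h
  obtain ⟨μ₀, hμ₀, C, hC⟩ := exists_inverse_expansion (P_mul_P V) hcd hPN hNP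
    (by rw [hN0]; exact Q_mul_M_mul_Qm₀invQ hreg) (by rw [hN0]; exact Qm₀invQ_mul_M_mul_Q hreg)
    (N_succ V) p K
  refine ⟨μ₀, hμ₀, C + ‖Qm₀invQ V‖, weightedRem V p, fun μ hre him hμ => ?_⟩
  have hμ0 : μ ≠ 0 := fun h => by simp [h] at hre
  have hμp : μ ^ p ≠ 0 := pow_ne_zero p hμ0
  obtain ⟨B, hB₁, hB₂, hB⟩ := hC μ hμ0 hμ _ (hK μ hre him)
  have hinv : Ring.inverse (U V + vRv V μ) = B :=
    Ring.inverse_unit (⟨_, B, hB₁, hB₂⟩ : (L2 →L[ℂ] L2)ˣ)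
  refine ⟨?_, perturbedResolvent V μ B,
    isResolvent_perturbedResolvent hre him hV1 hV2 hB₁ hB₂, ?_⟩
  -- The sum `∑_{k < p} μ^k N_k` contains `N_0` only if `p ≥ 1`, which is why `p = 0` is separate.
  · rw [weightedRem, hinv, norm_smul, norm_inv, norm_pow, inv_mul_le_iff₀ (by positivity)]
    rcases p with _ | p
    · simp only [Finset.range_zero, Finset.sum_empty, sub_zero, pow_zero, mul_one, one_mul] at hB ⊢
      rw [Finset.Icc_eq_empty (by norm_num), Finset.sum_empty, sub_zero, add_comm]
      exact (norm_sub_le _ _).trans (add_le_add le_rfl hB)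
    · have hS : Qm₀invQ V - ∑ j ∈ Finset.Icc 1 (p + 1 - 1), μ ^ j • M' V j =
          ∑ k ∈ Finset.range (p + 1), μ ^ k • N V k := by
        rw [Finset.range_eq_Ico, Finset.sum_eq_sum_Ico_succ_bot (Nat.succ_pos p), pow_zero,
          one_smul, hN0, Nat.add_sub_cancel, zero_add, ← Finset.Ico_succ_right_eq_Icc]
        simp only [M', smul_neg, Finset.sum_neg_distrib, sub_neg_eq_add]
        rfl
      rw [hS, norm_sub_rev, mul_comm]
      refine hB.trans (mul_le_mul_of_nonneg_right ?_ (by positivity))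
      linarith [norm_nonneg (Qm₀invQ V)]
  · have hW := isWeighted_perturbedResolvent hre him hV1 hB₁ hB₂
    have hfin : U V - Qm₀invQ V + ∑ j ∈ Finset.Icc 1 (p - 1), μ ^ j • M' V j
        + μ ^ p • weightedRem V p μ = U V - B := by
      rw [weightedRem, hinv, smul_smul, mul_inv_cancel₀ hμp, one_smul]
      abel
    rw [hfin]
    exact hW
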